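/- Call a function $h:\mathbb{R}^n\to\{\pm1\}$ a linear threshold function (LTF) if $h(x)=\mathrm{sign}(w\cdot x+\theta)$ for some $w\in\mathbb{R}^n$, $\theta\in\mathbb{R}$ (with $\mathrm{sign}(0)=1$; $w=0$ is allowed, so constants are LTFs). The indicator function of an intersection of $k$ LTFs $h_1,\dots,h_k$ is the function $f:\mathbb{R}^n\to\{0,1\}$ with $f(x)=1$ if and only if $h_i(x)=1$ for all $i$; for $k=0$ it is the constant $1$. There is an absolute constant $C>0$ such that the following holds for all integers $n\ge 0$ and $k\ge 1$ and all real $\delta$ with $0<\delta\le k/2$. Let $G\sim N(0,I_n)$, let $f:\mathbb{R}^n\to\{0,1\}$ be the indicator function of an intersection of $k$ LTFs, and let $V\subseteq\mathbb{R}^n$ be a linear subspace. Suppose that for every unit vector $v$ orthogonal to $V$ and every one-variable real polynomial $p$ of degree at most $2$ with $\mathbf{E}[p(Z)]=0$ and $\mathbf{E}[p(Z)^2]=1$ for $Z\sim N(0,1)$, one has $$\left|\mathbf{E}[f(G)\,p(v\cdot G)]\right|<\delta .$$ Then there is a function $g:\mathbb{R}^n\to\{0,1\}$, the indicator function of an intersection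 of at most $k$ LTFs, such that $g(x)=g(\pi_V(x))$ for all $x\in\mathbb{R}^n$, where $\pi_V$ is the orthogonal projection onto $V$, and $$\|f-g\|_1=\mathbf{E}\left[|f(G)-g(G)|\right]\le C\,\delta^{1/11}\,k^{15/11}\,\log^{2/11}(k/\delta).$$ -/

import Mathlib

open MeasureTheory ProbabilityTheory

/-- A linear threshold function on `ℝⁿ`: `h(x) = sign(w · x + θ)`, with values in `{±1}` and the
convention `sign(0) = 1`. Polynomials of degree at most `1` are allowed, so `w = 0` is permitted
and the two constant functions are linear threshold functions. -/
def IsLTF {n : ℕ} (h : EuclideanSpace ℝ (Fin n) → ℝ) : Prop :=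
  ∃ (w : EuclideanSpace ℝ (Fin n)) (θ : ℝ), ∀ x, h x = if 0 ≤ inner ℝ w x + θ then 1 else -1

open Classical in
/-- `f` is the `{0,1}`-valued indicator function of an intersection of `k` linear threshold
functions: there are `k` of them such that `f x = 1` if all of them equal `1` at `x`, and
`f x = 0` otherwise. -/
def IsIntersectionOfLTFs {n : ℕ} (k : ℕ) (f : EuclideanSpace ℝ (Fin n) → ℝ) : Prop :=
  ∃ h : Fin k → EuclideanSpace ℝ (Fin n) → ℝ,
    (∀ i, IsLTF (h i)) ∧ ∀ x, f x = if ∀ i, h i x = 1 then 1 else 0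

/-- A real polynomial in one variable of degree at most `2` which has mean `0` and second moment
`1` under the standard Gaussian distribution on `ℝ`. -/
def IsNormalizedMeanZeroQuadratic (p : Polynomial ℝ) : Prop :=
  p.natDegree ≤ 2 ∧ ∫ t, p.eval t ∂(gaussianReal 0 1) = 0 ∧
    ∫ t, (p.eval t) ^ 2 ∂(gaussianReal 0 1) = 1

/-! Let `K` be the intersection, `γ` the Gaussian measure and `μ = δ ^ (1/22)`. Everything rests on
the Poincaré inequality with constant 1 for `γ` restricted to a closed convex set
(`setIntegral_poincare`). It is the second-order expansion of the Prékopa–Leindler inequality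
applied to `exp (± ε h)` on the set.

It is used in two ways. First, if `v ⟂ V` is a unit vector, the moment hypothesis makes `v · x`
nearly extremal for Poincaré on `K`: gradient of length 1, mean nearly 0, mean square over `K`
hardly below 1. Let `w · x + θ ≥ 0` be one of the half-spaces, with `v · w = c > 0`. Adding a small
multiple of `ζ = exp (-(w · x + θ) / s)` to `v · x` shortens the gradient by an amount linear in `∫
ζ`, which would violate Poincaré unless `∫ ζ` over `K` is tiny. So `K` has almost no mass near that
hyperplane (`setIntegral_exp_neg_le`).

Second, half-spaces with this property can be dropped. Let `K₀ ⊇ K` be the intersection of the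
others. A function that vanishes on `K₀ \ K` and is close to 1 on most of `K` has little Dirichlet
energy, so Poincaré on `K₀` forbids both pieces from being large
(`measureReal_sub_measureReal_inter_mul_le`).

If `γ K ≤ k μ²`, take `g = 0`. Otherwise drop every half-space whose normal is further than `μ³`
from `V`, and project the remaining normals to `V`, at a cost of `3 μ²` each. The total error is at
most `19 k μ² = 19 k δ ^ (1/11)`. The asserted bound is weaker, since `k ^ (15/11) ≥ k` and the
logarithmic factor is at least `1/2`. When `μ` is not small, a large constant makes `g = 0`
sufficient. -/

/-! ### Brunn–Minkowski and Prékopa–Leindler on the line -/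

theorem Real.volume_add_le_of_midpoint_isCompact {A B : Set ℝ} {C : Set ℝ}
    (hA : IsCompact A) (hB : IsCompact B) (hA0 : A.Nonempty) (hB0 : B.Nonempty)
    (h : ∀ a ∈ A, ∀ b ∈ B, (a + b) / 2 ∈ C) :
    volume A + volume B ≤ 2 * volume C := by
  obtain ⟨a, ha, haM⟩ := hA.exists_isGreatest hA0
  obtain ⟨b, hb, hbm⟩ := hB.exists_isLeast hB0
  -- `2C` contains the translates `A + b` and `a + B`, which meet in one point
  have h1 : (fun x => x - b) ⁻¹' A ∪ (fun x => x - a) ⁻¹' B ⊆ (fun x => (2 : ℝ)⁻¹ * x) ⁻¹' C := by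
    rintro x (hx | hx)
    · have := h _ hx _ hb
      simp only [Set.mem_preimage] at *
      convert this using 1; ring
    · have := h _ ha _ hx
      simp only [Set.mem_preimage] at *
      convert this using 1; ring
  have h2 : volume ((fun x => (2 : ℝ)⁻¹ * x) ⁻¹' C) = 2 * volume C := by
    rw [Real.volume_preimage_mul_left (by norm_num)]; simp
  rw [← h2]
  refine le_trans ?_ (measure_mono h1)
  rw [measure_union₀']
  · simp only [sub_eq_add_neg, measure_preimage_add_right, le_refl]
  · exact ((hA.measurableSet).preimage (by fun_prop)).nullMeasurableSet
  · refine measure_mono_null (t := {a + b}) ?_ (by simp)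
    rintro x ⟨hx, hx'⟩
    have h3 := haM hx
    have h4 := hbm hx'
    simp only [Set.mem_singleton_iff]
    linarith

theorem Real.volume_add_le_of_midpoint {A B C : Set ℝ} (hA : MeasurableSet A)
    (hB : MeasurableSet B) (hA0 : A.Nonempty) (hB0 : B.Nonempty)
    (h : ∀ a ∈ A, ∀ b ∈ B, (a + b) / 2 ∈ C) :
    volume A + volume B ≤ 2 * volume C := by
  obtain ⟨a, ha⟩ := hA0
  obtain ⟨b, hb⟩ := hB0
  rw [hA.measure_eq_iSup_isCompact, hB.measure_eq_iSup_isCompact]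
  have key : ∀ K ⊆ A, IsCompact K → ∀ L ⊆ B, IsCompact L → volume K + volume L ≤ 2 * volume C := by
    intro K hKA hK L hLB hL
    -- The approximating compact sets may be empty; adjoining a point of `A` or `B` repairs this.
    refine le_trans (add_le_add (measure_mono (Set.subset_insert a K))
      (measure_mono (Set.subset_insert b L))) ?_
    refine volume_add_le_of_midpoint_isCompact (hK.insert a) (hL.insert b)
      (Set.insert_nonempty _ _) (Set.insert_nonempty _ _) fun x hx y hy => h x ?_ y ?_
    · exact Set.insert_subset ha hKA hx
    · exact Set.insert_subset hb hLB hy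
  simp only [iSup_and']
  refine ENNReal.biSup_add_biSup_le' ⟨∅, by simp⟩ ⟨∅, by simp⟩ ?_
  exact fun K hK L hL => key K hK.1 hK.2 L hL.1 hL.2

/-- Brunn–Minkowski on superlevel sets, integrated over the level. Both suprema being 1 is what
makes the superlevel sets of `u` and `v` nonempty for exactly the same levels `0 < t < 1`. The
conclusion is additive; the product form follows by scaling and AM–GM. -/
theorem lintegral_mul_lintegral_le_of_midpoint_aux {u v w : ℝ → ℝ} (hu : Measurable u)
    (hv : Measurable v) (hw : Measurable w) (hu0 : ∀ x, 0 ≤ u x) (hv0 : ∀ x, 0 ≤ v x)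
    (hw0 : ∀ x, 0 ≤ w x) (hu1 : ∀ x, u x ≤ 1) (hv1 : ∀ x, v x ≤ 1)
    (hus : ∀ t < 1, ∃ x, t < u x) (hvs : ∀ t < 1, ∃ x, t < v x)
    (h : ∀ x y, u x * v y ≤ w ((x + y) / 2) ^ 2) :
    (∫⁻ x, ENNReal.ofReal (u x)) + (∫⁻ x, ENNReal.ofReal (v x)) ≤
      2 * ∫⁻ x, ENNReal.ofReal (w x) := by
  rw [lintegral_eq_lintegral_meas_lt _ (ae_of_all _ hu0) hu.aemeasurable,
    lintegral_eq_lintegral_meas_lt _ (ae_of_all _ hv0) hv.aemeasurable,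
    lintegral_eq_lintegral_meas_lt _ (ae_of_all _ hw0) hw.aemeasurable]
  rw [← lintegral_const_mul', ← lintegral_add_left]
  · refine setLIntegral_mono_ae' measurableSet_Ioi (ae_of_all _ fun t ht => ?_)
    rcases lt_or_ge t 1 with h1 | h1
    · refine Real.volume_add_le_of_midpoint (hu measurableSet_Ioi) (hv measurableSet_Ioi)
        (hus t h1) (hvs t h1) fun a ha b hb => ?_
      have ht' : 0 < t := ht
      have ha' : t < u a := ha
      have hb' : t < v b := hb
      have := h a b
      have : t ^ 2 < w ((a + b) / 2) ^ 2 := by nlinarith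
      exact lt_of_pow_lt_pow_left₀ 2 (hw0 _) this
    · have e1 : {a | t < u a} = ∅ := by ext a; simpa using (hu1 a).trans h1
      have e2 : {a | t < v a} = ∅ := by ext a; simpa using (hv1 a).trans h1
      simp [e1, e2]
  · exact Antitone.measurable fun s t hst => measure_mono fun a ha => lt_of_le_of_lt hst ha
  · simp

/-- The Prékopa–Leindler inequality on the line, for midpoints and bounded functions. -/
theorem lintegral_mul_lintegral_le_of_midpoint {u v w : ℝ → ENNReal} (hu : Measurable u)
    (hv : Measurable v) (hw : Measurable w) {B : ENNReal} (hB : B ≠ ⊤) (huB : ∀ x, u x ≤ B)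
    (hvB : ∀ x, v x ≤ B) (h : ∀ x y, u x * v y ≤ w ((x + y) / 2) ^ 2) :
    (∫⁻ x, u x) * (∫⁻ x, v x) ≤ (∫⁻ x, w x) ^ 2 := by
  set a := ⨆ x, u x with ha
  set b := ⨆ x, v x with hb
  have hua : ∀ x, u x ≤ a := le_iSup u
  have hvb : ∀ x, v x ≤ b := le_iSup v
  have haT : a ≠ ⊤ := ne_top_of_le_ne_top hB (iSup_le huB)
  have hbT : b ≠ ⊤ := ne_top_of_le_ne_top hB (iSup_le hvB)
  rcases eq_or_ne a 0 with ha0 | ha0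
  · have : ∀ x, u x = 0 := fun x => le_antisymm (ha0 ▸ hua x) bot_le
    simp [this]
  rcases eq_or_ne b 0 with hb0 | hb0
  · have : ∀ x, v x = 0 := fun x => le_antisymm (hb0 ▸ hvb x) bot_le
    simp [this]
  set α := a.toReal with hα
  set β := b.toReal with hβ
  have hα0 : 0 < α := ENNReal.toReal_pos ha0 haT
  have hβ0 : 0 < β := ENNReal.toReal_pos hb0 hbT
  have huT : ∀ x, u x ≠ ⊤ := fun x => ne_top_of_le_ne_top haT (hua x)
  have hvT : ∀ x, v x ≠ ⊤ := fun x => ne_top_of_le_ne_top hbT (hvb x)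
  set σ := Real.sqrt (α * β) with hσ
  have hσ0 : 0 < σ := Real.sqrt_pos.2 (by positivity)
  have hσ2 : σ ^ 2 = α * β := Real.sq_sqrt (by positivity)
  -- Since `u x * v y ≤ α β = σ²`, capping `w` at `σ` preserves the midpoint hypothesis and makes
  -- `w` finite.
  set w' : ℝ → ENNReal := fun x => min (w x) (ENNReal.ofReal σ) with hw'
  have hw'm : Measurable w' := hw.min measurable_const
  have hw'T : ∀ x, w' x ≠ ⊤ := fun x => ne_top_of_le_ne_top ENNReal.ofReal_ne_top (min_le_right _ _)
  have key := lintegral_mul_lintegral_le_of_midpoint_aux (u := fun x => (u x).toReal / α)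
    (v := fun x => (v x).toReal / β) (w := fun x => (w' x).toReal / σ)
    (hu.ennreal_toReal.div_const _) (hv.ennreal_toReal.div_const _)
    (hw'm.ennreal_toReal.div_const _) (fun x => by positivity) (fun x => by positivity)
    (fun x => by positivity)
    (fun x => (div_le_one hα0).2 (ENNReal.toReal_mono haT (hua x)))
    (fun x => (div_le_one hβ0).2 (ENNReal.toReal_mono hbT (hvb x))) ?_ ?_ ?_
  · have hsc : ∀ (f : ℝ → ENNReal) (c : ℝ), 0 < c → (∀ x, f x ≠ ⊤) →
        ∫⁻ x, ENNReal.ofReal ((f x).toReal / c) = (∫⁻ x, f x) / ENNReal.ofReal c := by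
      intro f c hc hf
      rw [ENNReal.div_eq_inv_mul, ← lintegral_const_mul' _ _ (by simp [hc])]
      refine lintegral_congr fun x => ?_
      rw [ENNReal.ofReal_div_of_pos hc, ENNReal.ofReal_toReal (hf x), ENNReal.div_eq_inv_mul]
    rw [hsc u α hα0 huT, hsc v β hβ0 hvT, hsc w' σ hσ0 hw'T] at key
    have hle : ∫⁻ x, w' x ≤ ∫⁻ x, w x := lintegral_mono fun x => min_le_left _ _
    refine le_trans ?_ (pow_le_pow_left' hle 2)
    generalize ∫⁻ x, u x = U at *
    generalize ∫⁻ x, v x = V at *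
    generalize ∫⁻ x, w' x = W at *
    rcases eq_or_ne W ⊤ with hW | hW
    · simp [hW]
    have hR : U / ENNReal.ofReal α + V / ENNReal.ofReal β ≠ ⊤ :=
      ne_top_of_le_ne_top (ENNReal.mul_ne_top (by simp)
        (ENNReal.div_ne_top hW (by simpa using hσ0))) key
    have hU : U ≠ ⊤ := by
      rintro hU
      simp [hU, ENNReal.top_div] at hR
    have hV : V ≠ ⊤ := by
      rintro hV
      simp [hV, ENNReal.top_div] at hR
    lift U to NNReal using hU
    lift V to NNReal using hV
    lift W to NNReal using hW
    have key' := ENNReal.toReal_mono (ENNReal.mul_ne_top (by simp)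
        (ENNReal.div_ne_top (by simp) (by simpa using hσ0))) key
    rw [ENNReal.toReal_add (ENNReal.div_ne_top (by simp) (by simpa using hα0))
      (ENNReal.div_ne_top (by simp) (by simpa using hβ0))] at key'
    simp only [ENNReal.toReal_div, ENNReal.toReal_ofReal hα0.le, ENNReal.toReal_ofReal hβ0.le,
      ENNReal.toReal_mul, ENNReal.toReal_ofReal hσ0.le, ENNReal.coe_toReal] at key'
    norm_cast
    rw [← NNReal.coe_le_coe]
    push_cast
    have hU0 : (0 : ℝ) ≤ U := U.2
    have hV0 : (0 : ℝ) ≤ V := V.2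
    have hW0 : (0 : ℝ) ≤ W := W.2
    set p := (U : ℝ) / α with hp
    set q := (V : ℝ) / β with hq
    have hU' : (U : ℝ) = p * α := by rw [hp]; field_simp
    have hV' : (V : ℝ) = q * β := by rw [hq]; field_simp
    have hW' : (W : ℝ) = W / σ * σ := by field_simp
    have hr : (p + q) / 2 ≤ W / σ := by
      have : ENNReal.toReal 2 = 2 := rfl
      rw [this] at key'
      linarith
    have hp0 : 0 ≤ p := by positivity
    have hq0 : 0 ≤ q := by positivity
    rw [hU', hV', hW', mul_pow, hσ2]
    have : p * q ≤ (W / σ) ^ 2 := by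
      nlinarith [sq_nonneg (p - q), pow_le_pow_left₀ (by positivity) hr 2]
    calc p * α * (q * β) = (p * q) * (α * β) := by ring
      _ ≤ _ := by gcongr
  · intro t ht
    rcases lt_or_ge t 0 with h0 | h0
    · exact ⟨0, lt_of_lt_of_le h0 (by positivity)⟩
    have : ENNReal.ofReal (t * α) < a := by
      rw [← ENNReal.ofReal_toReal haT, ENNReal.ofReal_lt_ofReal_iff hα0]
      nlinarith
    obtain ⟨x, hx⟩ := lt_iSup_iff.1 this
    refine ⟨x, (lt_div_iff₀ hα0).2 ?_⟩
    exact (ENNReal.ofReal_lt_iff_lt_toReal (by positivity) (huT x)).1 hx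
  · intro t ht
    rcases lt_or_ge t 0 with h0 | h0
    · exact ⟨0, lt_of_lt_of_le h0 (by positivity)⟩
    have : ENNReal.ofReal (t * β) < b := by
      rw [← ENNReal.ofReal_toReal hbT, ENNReal.ofReal_lt_ofReal_iff hβ0]
      nlinarith
    obtain ⟨x, hx⟩ := lt_iSup_iff.1 this
    refine ⟨x, (lt_div_iff₀ hβ0).2 ?_⟩
    exact (ENNReal.ofReal_lt_iff_lt_toReal (by positivity) (hvT x)).1 hx
  · intro x y
    have h1 : u x * v y ≤ w' ((x + y) / 2) ^ 2 := by
      rcases min_choice (w ((x + y) / 2)) (ENNReal.ofReal σ) with h2 | h2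
      · simp only [hw', h2, h x y]
      · simp only [hw', h2]
        rw [← ENNReal.ofReal_pow hσ0.le, hσ2, ENNReal.ofReal_mul hα0.le,
          ENNReal.ofReal_toReal haT, ENNReal.ofReal_toReal hbT]
        exact mul_le_mul' (hua x) (hvb y)
    have h2 := ENNReal.toReal_mono (ENNReal.pow_ne_top (hw'T _)) h1
    rw [ENNReal.toReal_mul, ENNReal.toReal_pow] at h2
    rw [div_mul_div_comm, div_pow, hσ2]
    gcongr

/-! ### Prékopa–Leindler for the Gaussian measure -/

theorem lintegral_gaussianReal_mul_le_of_midpoint {u v w : ℝ → ENNReal} (hu : Measurable u)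
    (hv : Measurable v) (hw : Measurable w) {B : ENNReal} (hB : B ≠ ⊤) (huB : ∀ x, u x ≤ B)
    (hvB : ∀ x, v x ≤ B)
    (h : ∀ x y, u x * v y * ENNReal.ofReal (Real.exp (-((x - y) ^ 2 / 4))) ≤
      w ((x + y) / 2) ^ 2) :
    (∫⁻ x, u x ∂gaussianReal 0 1) * (∫⁻ x, v x ∂gaussianReal 0 1) ≤
      (∫⁻ x, w x ∂gaussianReal 0 1) ^ 2 := by
  have hρ := measurable_gaussianPDF 0 1
  have hden : ∀ f : ℝ → ENNReal, Measurable f → ∫⁻ x, f x ∂gaussianReal 0 1 =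
      ∫⁻ x, gaussianPDF 0 1 x * f x := by
    intro f hf
    rw [gaussianReal_of_var_ne_zero _ one_ne_zero, lintegral_withDensity_eq_lintegral_mul _ hρ hf]
    rfl
  have hρ1 : ∀ x, gaussianPDF 0 1 x ≤ ENNReal.ofReal (Real.sqrt (2 * Real.pi * 1))⁻¹ := by
    intro x
    refine ENNReal.ofReal_le_ofReal ?_
    rw [gaussianPDFReal]
    refine mul_le_of_le_one_right (by positivity) (Real.exp_le_one_iff.2 ?_)
    have := sq_nonneg (x - 0)
    push_cast
    linarith
  -- The parallelogram law in the exponent. This gain is the source of the Poincaré constant 1.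
  have hmid : ∀ x y, gaussianPDF 0 1 x * gaussianPDF 0 1 y =
      gaussianPDF 0 1 ((x + y) / 2) ^ 2 * ENNReal.ofReal (Real.exp (-((x - y) ^ 2 / 4))) := by
    intro x y
    simp only [gaussianPDF, gaussianPDFReal]
    rw [← ENNReal.ofReal_mul (by positivity), ← ENNReal.ofReal_pow (by positivity),
      ← ENNReal.ofReal_mul (by positivity)]
    congr 1
    rw [mul_pow, ← Real.exp_nat_mul, mul_mul_mul_comm, ← Real.exp_add, mul_assoc (_ ^ 2),
      ← Real.exp_add, sq (Real.sqrt _)⁻¹]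
    congr 2
    push_cast
    ring
  rw [hden u hu, hden v hv, hden w hw]
  refine lintegral_mul_lintegral_le_of_midpoint (hρ.mul hu) (hρ.mul hv) (hρ.mul hw)
    (B := ENNReal.ofReal (Real.sqrt (2 * Real.pi * 1))⁻¹ * B) (ENNReal.mul_ne_top ENNReal.ofReal_ne_top hB)
    (fun x => mul_le_mul' (hρ1 x) (huB x)) (fun x => mul_le_mul' (hρ1 x) (hvB x)) fun x y => ?_
  calc gaussianPDF 0 1 x * u x * (gaussianPDF 0 1 y * v y)
      = (gaussianPDF 0 1 x * gaussianPDF 0 1 y) * (u x * v y) := by ring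
    _ = gaussianPDF 0 1 ((x + y) / 2) ^ 2 *
        (u x * v y * ENNReal.ofReal (Real.exp (-((x - y) ^ 2 / 4)))) := by rw [hmid]; ring
    _ ≤ _ := by
        rw [mul_pow]
        gcongr
        exact h x y

theorem lintegral_pi_gaussianReal_mul_le_of_midpoint (n : ℕ) {u v w : (Fin n → ℝ) → ENNReal}
    (hu : Measurable u) (hv : Measurable v) (hw : Measurable w) {B : ENNReal} (hB : B ≠ ⊤)
    (huB : ∀ x, u x ≤ B) (hvB : ∀ x, v x ≤ B)
    (h : ∀ x y, u x * v y * ENNReal.ofReal (Real.exp (-(∑ i, (x i - y i) ^ 2 / 4))) ≤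
      w (fun i => (x i + y i) / 2) ^ 2) :
    (∫⁻ x, u x ∂Measure.pi fun _ => gaussianReal 0 1) *
      (∫⁻ x, v x ∂Measure.pi fun _ => gaussianReal 0 1) ≤
      (∫⁻ x, w x ∂Measure.pi fun _ => gaussianReal 0 1) ^ 2 := by
  induction n with
  | zero =>
    simp only [lintegral_unique, measure_univ, mul_one]
    have := h default default
    simp only [Finset.univ_eq_empty, Finset.sum_empty, neg_zero, Real.exp_zero,
      ENNReal.ofReal_one, mul_one] at this
    convert this
  | succ n ih =>
    have hsplit : ∀ f : (Fin (n + 1) → ℝ) → ENNReal, Measurable f →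
        ∫⁻ x, f x ∂Measure.pi (fun _ => gaussianReal 0 1) =
        ∫⁻ s, ∫⁻ y, f (Fin.cons s y) ∂Measure.pi (fun _ => gaussianReal 0 1) ∂gaussianReal 0 1 := by
      intro f hf
      have e := (measurePreserving_piFinSuccAbove (fun _ : Fin (n + 1) => gaussianReal 0 1) 0).symm
      rw [← e.lintegral_comp hf, lintegral_prod]
      · refine lintegral_congr fun s => lintegral_congr fun y => ?_
        simp [MeasurableEquiv.piFinSuccAbove, Fin.insertNthEquiv]
      · exact (hf.comp e.measurable).aemeasurable
    have hcons : Measurable fun p : ℝ × (Fin n → ℝ) => (Fin.cons p.1 p.2 : Fin (n + 1) → ℝ) := by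
      refine measurable_pi_iff.2 fun i => ?_
      refine Fin.cases ?_ (fun j => ?_) i
      · simpa using measurable_fst
      · simp only [Fin.cons_succ]; fun_prop
    have hsec : ∀ s, Measurable fun y : Fin n → ℝ => (Fin.cons s y : Fin (n + 1) → ℝ) := fun s =>
      hcons.comp (measurable_const.prodMk measurable_id)
    have hint : ∀ f : (Fin (n + 1) → ℝ) → ENNReal, Measurable f → Measurable fun s =>
        ∫⁻ y, f (Fin.cons s y) ∂Measure.pi (fun _ => gaussianReal 0 1) := fun f hf =>
      (hf.comp hcons).lintegral_prod_right'
    have hbd : ∀ f : (Fin (n + 1) → ℝ) → ENNReal, (∀ x, f x ≤ B) → ∀ s,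
        ∫⁻ y, f (Fin.cons s y) ∂Measure.pi (fun _ => gaussianReal 0 1) ≤ B := by
      intro f hf s
      refine (lintegral_mono fun y => hf _).trans ?_
      simp
    rw [hsplit u hu, hsplit v hv, hsplit w hw]
    refine lintegral_gaussianReal_mul_le_of_midpoint (hint u hu) (hint v hv) (hint w hw) hB
      (hbd u huB) (hbd v hvB) fun s t => ?_
    have hvt : Measurable fun y : Fin n → ℝ => v (Fin.cons t y) := hv.comp (hsec t)
    -- The Gaussian factor of the first coordinate is absorbed into `v`, so that the induction
    -- hypothesis applies to the sections.
    rw [mul_assoc, ← lintegral_mul_const _ hvt]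
    refine ih (hu.comp (hsec s)) (hvt.mul_const _) (hw.comp (hsec _)) (fun x => huB _)
      (fun x => ?_) fun x y => ?_
    · refine (mul_le_of_le_one_right' ?_).trans (hvB _)
      rw [ENNReal.ofReal_le_one, Real.exp_le_one_iff]
      have := sq_nonneg (s - t)
      linarith
    · have := h (Fin.cons s x) (Fin.cons t y)
      rw [Fin.sum_univ_succ] at this
      simp only [Fin.cons_zero, Fin.cons_succ, neg_add, Real.exp_add] at this
      rw [ENNReal.ofReal_mul (by positivity)] at this
      have e : (fun i => ((Fin.cons s x : Fin (n + 1) → ℝ) i + (Fin.cons t y : Fin (n + 1) → ℝ) i) / 2)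
          = Fin.cons ((s + t) / 2) fun i => (x i + y i) / 2 := by
        ext i
        refine Fin.cases ?_ (fun j => ?_) i <;> simp
      rw [e] at this
      simpa only [Function.comp, mul_assoc] using this

/-- The Prékopa–Leindler inequality relative to the standard Gaussian measure. -/
theorem lintegral_stdGaussian_mul_le_of_midpoint {n : ℕ}
    {u v w : EuclideanSpace ℝ (Fin n) → ENNReal} (hu : Measurable u) (hv : Measurable v)
    (hw : Measurable w) {B : ENNReal} (hB : B ≠ ⊤) (huB : ∀ x, u x ≤ B) (hvB : ∀ x, v x ≤ B)
    (h : ∀ z d, u (z + d) * v (z - d) * ENNReal.ofReal (Real.exp (-‖d‖ ^ 2)) ≤ w z ^ 2) :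
    (∫⁻ x, u x ∂stdGaussian (EuclideanSpace ℝ (Fin n))) *
      (∫⁻ x, v x ∂stdGaussian (EuclideanSpace ℝ (Fin n))) ≤
      (∫⁻ x, w x ∂stdGaussian (EuclideanSpace ℝ (Fin n))) ^ 2 := by
  have hm : Measurable (WithLp.toLp 2 : (Fin n → ℝ) → EuclideanSpace ℝ (Fin n)) := by fun_prop
  rw [← map_pi_eq_stdGaussian, lintegral_map hu hm, lintegral_map hv hm, lintegral_map hw hm]
  refine lintegral_pi_gaussianReal_mul_le_of_midpoint n (hu.comp hm) (hv.comp hm) (hw.comp hm) hB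
    (fun x => huB _) (fun x => hvB _) fun x y => ?_
  have := h (WithLp.toLp 2 fun i => (x i + y i) / 2) (WithLp.toLp 2 fun i => (x i - y i) / 2)
  rw [EuclideanSpace.real_norm_sq_eq] at this
  convert this using 3
  · congr 2
    ext i; simp; ring
  · congr 2
    ext i; simp; ring
  · congr 3
    ext i; simp; ring

/-! ### Poincaré inequality on convex sets -/

/-- Exponential form of the Poincaré inequality on a compact convex set, where `G` is an upper
bound for the size of the gradient of `h`, up to second-order terms. -/
theorem setIntegral_exp_mul_setIntegral_exp_neg_le {n : ℕ} {K : Set (EuclideanSpace ℝ (Fin n))}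
    (hK : IsCompact K) (hKc : Convex ℝ K) {h G : EuclideanSpace ℝ (Fin n) → ℝ}
    (hh : Continuous h) (hG : Continuous G) {M : ℝ}
    (hGh : ∀ z d, z + d ∈ K → z - d ∈ K → h (z + d) - h (z - d) ≤ 2 * G z * ‖d‖ + M * ‖d‖ ^ 2)
    {ε : ℝ} (hε : 0 < ε) (hεM : ε * M < 1) :
    (∫ x in K, Real.exp (ε * h x) ∂stdGaussian (EuclideanSpace ℝ (Fin n))) *
      (∫ x in K, Real.exp (-(ε * h x)) ∂stdGaussian (EuclideanSpace ℝ (Fin n))) ≤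
      (∫ x in K, Real.exp (ε ^ 2 * G x ^ 2 / (2 * (1 - ε * M)))
        ∂stdGaussian (EuclideanSpace ℝ (Fin n))) ^ 2 := by
  set γ := stdGaussian (EuclideanSpace ℝ (Fin n))
  have hKm := hK.measurableSet
  obtain ⟨A, hA⟩ := hK.exists_bound_of_continuousOn hh.continuousOn
  have hconv : ∀ f : EuclideanSpace ℝ (Fin n) → ℝ, Continuous f → (∀ x, 0 ≤ f x) →
      ENNReal.ofReal (∫ x in K, f x ∂γ) =
        ∫⁻ x, K.indicator (fun x => ENNReal.ofReal (f x)) x ∂γ := by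
    intro f hf hf0
    rw [ofReal_integral_eq_lintegral_ofReal (hf.continuousOn.integrableOn_compact hK)
      (ae_of_all _ hf0), lintegral_indicator hKm]
  have hmeas : ∀ f : EuclideanSpace ℝ (Fin n) → ℝ, Continuous f →
      Measurable (K.indicator fun x => ENNReal.ofReal (f x)) := fun f hf =>
    (hf.measurable.ennreal_ofReal).indicator hKm
  have hc1 : Continuous fun x => Real.exp (ε * h x) := by fun_prop
  have hc2 : Continuous fun x => Real.exp (-(ε * h x)) := by fun_prop
  have hc3 : Continuous fun x => Real.exp (ε ^ 2 * G x ^ 2 / (2 * (1 - ε * M))) := by fun_prop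
  have hbd : ∀ x ∈ K, ε * h x ≤ ε * A ∧ -(ε * h x) ≤ ε * A := by
    intro x hx
    have := abs_le.1 (hA x hx)
    constructor <;> nlinarith
  have key := lintegral_stdGaussian_mul_le_of_midpoint (hmeas _ hc1) (hmeas _ hc2) (hmeas _ hc3)
    (B := ENNReal.ofReal (Real.exp (ε * A))) ENNReal.ofReal_ne_top
    (fun x => Set.indicator_apply_le' (fun hx => ENNReal.ofReal_le_ofReal
      (Real.exp_le_exp.2 (hbd x hx).1)) fun _ => bot_le)
    (fun x => Set.indicator_apply_le' (fun hx => ENNReal.ofReal_le_ofReal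
      (Real.exp_le_exp.2 (hbd x hx).2)) fun _ => bot_le) ?_
  · rw [← hconv _ hc1 fun _ => by positivity, ← hconv _ hc2 fun _ => by positivity,
      ← hconv _ hc3 fun _ => by positivity,
      ← ENNReal.ofReal_mul (integral_nonneg fun _ => by positivity),
      ← ENNReal.ofReal_pow (integral_nonneg fun _ => by positivity)] at key
    exact (ENNReal.ofReal_le_ofReal_iff (by positivity)).1 key
  · intro z d
    by_cases h1 : z + d ∈ K
    · by_cases h2 : z - d ∈ K
      · have h3 : z ∈ K := by
          have := hKc h1 h2 (a := 1 / 2) (b := 1 / 2) (by norm_num) (by norm_num) (by norm_num)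
          convert this using 1
          module
        rw [Set.indicator_of_mem h1, Set.indicator_of_mem h2, Set.indicator_of_mem h3,
          ← ENNReal.ofReal_mul (by positivity), ← ENNReal.ofReal_mul (by positivity),
          ← ENNReal.ofReal_pow (by positivity), ← Real.exp_add, ← Real.exp_add, ← Real.exp_nat_mul]
        refine ENNReal.ofReal_le_ofReal (Real.exp_le_exp.2 ?_)
        have h4 := mul_le_mul_of_nonneg_left (hGh z d h1 h2) hε.le
        set b := 1 - ε * M with hb
        have hb0 : 0 < b := by linarith
        -- Completing the square in `‖d‖`: the Gaussian gain `-‖d‖²` beats the second-order error `ε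
        -- M ‖d‖²`, leaving `b = 1 - ε M > 0`.
        have h5 : 2 * (ε * G z) * ‖d‖ - b * ‖d‖ ^ 2 ≤ (ε * G z) ^ 2 / b := by
          rw [le_div_iff₀ hb0]
          nlinarith [sq_nonneg (ε * G z - b * ‖d‖)]
        have h6 : ((2 : ℕ) : ℝ) * (ε ^ 2 * G z ^ 2 / (2 * b)) = (ε * G z) ^ 2 / b := by
          push_cast; field_simp
        rw [h6]
        have : ε * M = 1 - b := by rw [hb]; ring
        nlinarith
      · simp [h2]
    · simp [h1]

/-- Expand the exponential form in `ε`: the left side is `(I0 + ε² I2 / 2)² - ε² I1²` and the right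
side `(I0 + ε² J / 2)²`, up to `O(ε³)`. Comparing coefficients of `ε²` gives the claim; `M` enters
only at higher order. Compactness makes the Taylor errors uniform. -/
theorem setIntegral_poincare_of_isCompact {n : ℕ} {K : Set (EuclideanSpace ℝ (Fin n))}
    (hK : IsCompact K) (hKc : Convex ℝ K) {h G : EuclideanSpace ℝ (Fin n) → ℝ}
    (hh : Continuous h) (hG : Continuous G) {M : ℝ} (hM : 0 ≤ M)
    (hGh : ∀ z d, z + d ∈ K → z - d ∈ K → h (z + d) - h (z - d) ≤ 2 * G z * ‖d‖ + M * ‖d‖ ^ 2) :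
    (stdGaussian (EuclideanSpace ℝ (Fin n))).real K *
        (∫ x in K, h x ^ 2 ∂stdGaussian (EuclideanSpace ℝ (Fin n))) ≤
      (∫ x in K, h x ∂stdGaussian (EuclideanSpace ℝ (Fin n))) ^ 2 +
      (stdGaussian (EuclideanSpace ℝ (Fin n))).real K *
        ∫ x in K, G x ^ 2 ∂stdGaussian (EuclideanSpace ℝ (Fin n)) := by
  set γ := stdGaussian (EuclideanSpace ℝ (Fin n))
  have hKm := hK.measurableSet
  obtain ⟨A₁, hA₁⟩ := hK.exists_bound_of_continuousOn hh.continuousOn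
  obtain ⟨A₂, hA₂⟩ := hK.exists_bound_of_continuousOn hG.continuousOn
  obtain ⟨A, hA, hA1, hA2⟩ : ∃ A : ℝ, 0 < A ∧ A₁ ≤ A ∧ A₂ ≤ A :=
    ⟨max 1 (max A₁ A₂), by positivity, by simp, by simp⟩
  have hint : ∀ f : EuclideanSpace ℝ (Fin n) → ℝ, Continuous f → IntegrableOn f K γ := fun f hf =>
    hf.continuousOn.integrableOn_compact hK
  set I0 := γ.real K
  set I1 := ∫ x in K, h x ∂γ
  set I2 := ∫ x in K, h x ^ 2 ∂γ
  set J := ∫ x in K, G x ^ 2 ∂γ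
  have hI0 : 0 ≤ I0 := measureReal_nonneg
  have hI2 : 0 ≤ I2 := integral_nonneg fun _ => by positivity
  have hJ : 0 ≤ J := integral_nonneg fun _ => by positivity
  rcases hI0.eq_or_lt with h0 | h0
  · rw [← h0]; simpa using sq_nonneg I1
  let p : ℝ → ℝ := fun ε => I2 / 2 - ε * A ^ 3 * I0
  let R : ℝ → ℝ := fun ε => J / 2 + ε * M * J + ε ^ 2 * A ^ 4 * I0
  have hcp : Continuous p := by fun_prop
  have hcR : Continuous R := by fun_prop
  have hlow : ∀ ε : ℝ, 0 < ε → ε * A ≤ 1 → ∀ σ : ℝ, σ ^ 2 = 1 →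
      I0 + ε ^ 2 * p ε + σ * ε * I1 ≤ ∫ x in K, Real.exp (σ * (ε * h x)) ∂γ := by
    intro ε hε hεA σ hσ
    have e : I0 + ε ^ 2 * p ε + σ * ε * I1 =
        ∫ x in K, (1 + σ * (ε * h x) + ε ^ 2 / 2 * h x ^ 2 - ε ^ 3 * A ^ 3) ∂γ := by
      rw [integral_sub (hint _ (by fun_prop)) (hint _ (by fun_prop)),
        integral_add (hint _ (by fun_prop)) (hint _ (by fun_prop)),
        integral_add (hint _ (by fun_prop)) (hint _ (by fun_prop))]
      simp only [integral_const_mul, setIntegral_const, smul_eq_mul]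
      simp only [p, I0, I1, I2]
      ring
    rw [e]
    refine setIntegral_mono_on (hint _ (by fun_prop)) (hint _ (by fun_prop)) hKm fun x hx => ?_
    have h1 : |σ * (ε * h x)| ≤ ε * A := by
      have hσ1 : |σ| = 1 := by
        rw [← sq_eq_sq₀ (abs_nonneg _) zero_le_one, sq_abs, hσ]; norm_num
      rw [abs_mul, abs_mul, hσ1, one_mul, abs_of_pos hε]
      exact mul_le_mul_of_nonneg_left ((hA₁ x hx).trans hA1) hε.le
    have h2 := Real.exp_bound (h1.trans hεA) (n := 3) (by norm_num)
    norm_num [Finset.sum_range_succ, Nat.factorial] at h2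
    have h3 : |σ * (ε * h x)| ^ 3 ≤ ε ^ 3 * A ^ 3 := by
      rw [← mul_pow]; exact pow_le_pow_left₀ (abs_nonneg _) h1 3
    have h4 := (abs_le.1 h2).1
    have h5 : (σ * (ε * h x)) ^ 2 = ε ^ 2 * h x ^ 2 := by
      rw [mul_pow, hσ]; ring
    rw [h5] at h4
    have : 0 ≤ |σ * (ε * h x)| ^ 3 := by positivity
    norm_num at h4
    rw [abs_mul, abs_mul] at h3 this
    linarith
  have hup : ∀ ε : ℝ, 0 < ε → ε * A ≤ 1 → ε * M ≤ 1 / 2 →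
      ∫ x in K, Real.exp (ε ^ 2 * G x ^ 2 / (2 * (1 - ε * M))) ∂γ ≤ I0 + ε ^ 2 * R ε := by
    intro ε hε hεA hεM
    have e : I0 + ε ^ 2 * R ε =
        ∫ x in K, (1 + (ε ^ 2 / 2 * (1 + 2 * (ε * M))) * G x ^ 2 + ε ^ 4 * A ^ 4) ∂γ := by
      rw [integral_add (hint _ (by fun_prop)) (hint _ (by fun_prop)),
        integral_add (hint _ (by fun_prop)) (hint _ (by fun_prop))]
      simp only [integral_const_mul, setIntegral_const, smul_eq_mul]
      simp only [R, I0, J]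
      ring
    rw [e]
    refine setIntegral_mono_on (hint _ (by fun_prop)) (hint _ (by fun_prop)) hKm fun x hx => ?_
    set y := ε ^ 2 * G x ^ 2 / (2 * (1 - ε * M)) with hy
    have hb : 0 < 2 * (1 - ε * M) := by linarith
    have hεM0 : 0 ≤ ε * M := by positivity
    have hG2 : G x ^ 2 ≤ A ^ 2 := by
      rw [← sq_abs]; exact pow_le_pow_left₀ (abs_nonneg _) ((hA₂ x hx).trans hA2) 2
    have hy0 : 0 ≤ y := by positivity
    have hy1 : y ≤ ε ^ 2 / 2 * (1 + 2 * (ε * M)) * G x ^ 2 := by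
      rw [hy, div_le_iff₀ hb]
      have : 0 ≤ ε ^ 2 * G x ^ 2 := by positivity
      nlinarith [mul_nonneg this (mul_nonneg hεM0 (sub_nonneg.2 hεM))]
    have hy2 : y ≤ ε ^ 2 * A ^ 2 := by
      refine hy1.trans ?_
      have h1 : ε ^ 2 / 2 * (1 + 2 * (ε * M)) ≤ ε ^ 2 := by nlinarith [sq_nonneg ε]
      gcongr
    have hy3 : ε ^ 2 * A ^ 2 ≤ 1 := by
      rw [← mul_pow]; exact pow_le_one₀ (by positivity) hεA
    have h1 := (abs_le.1 (Real.abs_exp_sub_one_sub_id_le (x := y)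
      (by rw [abs_of_nonneg hy0]; linarith))).2
    have h2 : y ^ 2 ≤ ε ^ 4 * A ^ 4 := by
      calc y ^ 2 ≤ (ε ^ 2 * A ^ 2) ^ 2 := by gcongr
        _ = _ := by ring
    linarith
  have hmain : ∀ᶠ ε in nhdsWithin (0 : ℝ) (Set.Ioi 0),
      2 * I0 * p ε + ε ^ 2 * p ε ^ 2 - I1 ^ 2 ≤ 2 * I0 * R ε + ε ^ 2 * R ε ^ 2 := by
    have ev : ∀ (f : ℝ → ℝ) (c : ℝ), Continuous f → f 0 < c →
        ∀ᶠ ε in nhdsWithin (0 : ℝ) (Set.Ioi 0), f ε < c := fun f c hf h0 =>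
      ((hf.tendsto 0).eventually_lt_const h0).filter_mono nhdsWithin_le_nhds
    filter_upwards [self_mem_nhdsWithin, ev (fun ε => ε * A) 1 (by fun_prop) (by simp),
      ev (fun ε => ε * M) (1 / 2) (by fun_prop) (by simp),
      ev (fun ε => -(I0 + ε ^ 2 * p ε + 1 * ε * I1)) 0 (by fun_prop) (by simpa using h0)] with
      ε hε hεA hεM hpos
    have hε : 0 < ε := hε
    have h1 := setIntegral_exp_mul_setIntegral_exp_neg_le hK hKc hh hG hGh hε (by linarith)
    have h2 := hlow ε hε hεA.le 1 (by norm_num)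
    have h3 := hlow ε hε hεA.le (-1) (by norm_num)
    have h4 := hup ε hε hεA.le hεM.le
    simp only [one_mul, neg_one_mul] at h2 h3 hpos
    set X := ∫ x in K, Real.exp (ε * h x) ∂γ
    set Y := ∫ x in K, Real.exp (-(ε * h x)) ∂γ
    have hY : 0 ≤ Y := integral_nonneg fun _ => by positivity
    have hW : 0 ≤ ∫ x in K, Real.exp (ε ^ 2 * G x ^ 2 / (2 * (1 - ε * M))) ∂γ :=
      integral_nonneg fun _ => by positivity
    have h5 := h1.trans (pow_le_pow_left₀ hW h4 2)
    -- Multiplying the lower bounds needs one of them to be nonnegative; for small `ε` this follows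
    -- from `I0 > 0`.
    have h6 : (I0 + ε ^ 2 * p ε + ε * I1) * (I0 + ε ^ 2 * p ε + -ε * I1) ≤ X * Y := by
      refine le_trans (mul_le_mul_of_nonneg_left h3 (by linarith)) ?_
      exact mul_le_mul_of_nonneg_right h2 hY
    have h7 := h6.trans h5
    have h8 : ε ^ 2 * (2 * I0 * p ε + ε ^ 2 * p ε ^ 2 - I1 ^ 2) ≤
        ε ^ 2 * (2 * I0 * R ε + ε ^ 2 * R ε ^ 2) := by nlinarith
    exact le_of_mul_le_mul_left h8 (by positivity)
  have t1 : Filter.Tendsto (fun ε => 2 * I0 * p ε + ε ^ 2 * p ε ^ 2 - I1 ^ 2)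
      (nhdsWithin 0 (Set.Ioi 0)) (nhds (I0 * I2 - I1 ^ 2)) :=
    tendsto_nhdsWithin_of_tendsto_nhds (Continuous.tendsto' (by fun_prop) _ _ (by simp [p]; ring))
  have t2 : Filter.Tendsto (fun ε => 2 * I0 * R ε + ε ^ 2 * R ε ^ 2)
      (nhdsWithin 0 (Set.Ioi 0)) (nhds (I0 * J)) :=
    tendsto_nhdsWithin_of_tendsto_nhds (Continuous.tendsto' (by fun_prop) _ _ (by simp [R]; ring))
  have := le_of_tendsto_of_tendsto t1 t2 hmain
  linarith

/-- The Poincaré inequality for the restriction of the standard Gaussian measure to a closed convex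
set, where `G` is an upper bound for the size of the gradient of `h`, up to second-order terms. -/
theorem setIntegral_poincare {n : ℕ} {K : Set (EuclideanSpace ℝ (Fin n))}
    (hK : IsClosed K) (hKc : Convex ℝ K) {h G : EuclideanSpace ℝ (Fin n) → ℝ}
    (hh : Continuous h) (hG : Continuous G) {M : ℝ} (hM : 0 ≤ M)
    (hi : IntegrableOn h K (stdGaussian (EuclideanSpace ℝ (Fin n))))
    (hi2 : IntegrableOn (fun x => h x ^ 2) K (stdGaussian (EuclideanSpace ℝ (Fin n))))
    (hiG : IntegrableOn (fun x => G x ^ 2) K (stdGaussian (EuclideanSpace ℝ (Fin n))))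
    (hGh : ∀ z d, z + d ∈ K → z - d ∈ K → h (z + d) - h (z - d) ≤ 2 * G z * ‖d‖ + M * ‖d‖ ^ 2) :
    (stdGaussian (EuclideanSpace ℝ (Fin n))).real K *
        (∫ x in K, h x ^ 2 ∂stdGaussian (EuclideanSpace ℝ (Fin n))) ≤
      (∫ x in K, h x ∂stdGaussian (EuclideanSpace ℝ (Fin n))) ^ 2 +
      (stdGaussian (EuclideanSpace ℝ (Fin n))).real K *
        ∫ x in K, G x ^ 2 ∂stdGaussian (EuclideanSpace ℝ (Fin n)) := by
  set γ := stdGaussian (EuclideanSpace ℝ (Fin n))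
  let B : ℕ → Set (EuclideanSpace ℝ (Fin n)) := fun m => K ∩ Metric.closedBall 0 m
  have hBm : ∀ m, MeasurableSet (B m) := fun m =>
    hK.measurableSet.inter measurableSet_closedBall
  have hmono : Monotone B := fun a b hab =>
    Set.inter_subset_inter_right _ (Metric.closedBall_subset_closedBall (by exact_mod_cast hab))
  have hU : ⋃ m, B m = K := by
    rw [← Set.inter_iUnion, Metric.iUnion_closedBall_nat, Set.inter_univ]
  have hlim : ∀ f : EuclideanSpace ℝ (Fin n) → ℝ, IntegrableOn f K γ →
      Filter.Tendsto (fun m => ∫ x in B m, f x ∂γ) Filter.atTop (nhds (∫ x in K, f x ∂γ)) := by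
    intro f hf
    have := tendsto_setIntegral_of_monotone hBm hmono (f := f) (μ := γ) (by rwa [hU])
    rwa [hU] at this
  have h1 : Filter.Tendsto (fun m => γ.real (B m)) Filter.atTop (nhds (γ.real K)) := by
    have := hlim (fun _ => 1) (integrable_const _)
    simpa using this
  refine le_of_tendsto_of_tendsto' (h1.mul (hlim _ hi2)) (((hlim _ hi).pow 2).add
    (h1.mul (hlim _ hiG))) fun m => ?_
  exact setIntegral_poincare_of_isCompact ((isCompact_closedBall 0 (m : ℝ)).inter_left hK)
    (hKc.inter (convex_closedBall 0 _)) hh hG hM fun z d h1 h2 => hGh z d h1.1 h2.1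

/-! ### Little mass near a transversal hyperplane -/

/-- Tangent-line bounds for `exp (-t)`, with an error uniform on the half-line. They supply the
second-order hypothesis of the Poincaré inequality without any derivatives. -/
theorem Real.exp_neg_add_taylor {t a : ℝ} (ht : 0 ≤ t) (hta : 0 ≤ t + a) :
    Real.exp (-t) - a * Real.exp (-t) ≤ Real.exp (-(t + a)) ∧
      Real.exp (-(t + a)) ≤ Real.exp (-t) - a * Real.exp (-t) + a ^ 2 := by
  have e : Real.exp (-(t + a)) = Real.exp (-t) * Real.exp (-a) := by
    rw [← Real.exp_add]; congr 1; ring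
  have hpos := Real.exp_pos (-t)
  rw [e]
  refine ⟨by nlinarith [Real.add_one_le_exp (-a)], ?_⟩
  rcases le_or_gt 0 a with ha | ha
  · have h1 : Real.exp (-t) ≤ 1 := Real.exp_le_one_iff.2 (by linarith)
    have h2 : Real.exp (-a) ≤ 1 - a + a ^ 2 := by
      have h3 : Real.exp (-a) * Real.exp a = 1 := by rw [← Real.exp_add]; simp
      have h4 := Real.add_one_le_exp a
      have h5 := Real.exp_pos (-a)
      have h6 : Real.exp (-a) * (a + 1) ≤ 1 := by nlinarith
      have h7 : 0 ≤ a ^ 3 := by positivity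
      nlinarith
    nlinarith [sq_nonneg a]
  · have h1 : Real.exp (-t) * Real.exp (-a) ≤ 1 := by
      rw [← Real.exp_add]; exact Real.exp_le_one_iff.2 (by linarith)
    have h2 : Real.exp (-t) ≤ Real.exp a := Real.exp_le_exp.2 (by linarith)
    have h3 : Real.exp (-a) * Real.exp a = 1 := by rw [← Real.exp_add]; simp
    have h4 := Real.add_one_le_exp a
    have h5 : 0 ≤ Real.exp (-a) - 1 + a := by linarith [Real.add_one_le_exp (-a)]
    have h6 : Real.exp (-t) * (Real.exp (-a) - 1 + a) ≤ Real.exp a * (Real.exp (-a) - 1 + a) :=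
      mul_le_mul_of_nonneg_right h2 h5
    have h7 : Real.exp a * (1 - a) ≥ (a + 1) * (1 - a) :=
      mul_le_mul_of_nonneg_right h4 (by linarith)
    nlinarith

theorem sq_setIntegral_le {α : Type*} [MeasurableSpace α] {μ : Measure α} [IsFiniteMeasure μ]
    {K : Set α} {f : α → ℝ} (hf : IntegrableOn f K μ) (hf2 : IntegrableOn (fun x => f x ^ 2) K μ) :
    (∫ x in K, f x ∂μ) ^ 2 ≤ μ.real K * ∫ x in K, f x ^ 2 ∂μ := by
  set κ := μ.real K
  set Z := ∫ x in K, f x ∂μ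
  have h : 0 ≤ ∫ x in K, (κ * f x - Z) ^ 2 ∂μ := integral_nonneg fun _ => by positivity
  have e : ∫ x in K, (κ * f x - Z) ^ 2 ∂μ = κ * (κ * (∫ x in K, f x ^ 2 ∂μ) - Z ^ 2) := by
    have : ∀ x, (κ * f x - Z) ^ 2 = κ ^ 2 * f x ^ 2 - 2 * κ * Z * f x + Z ^ 2 := fun x => by ring
    simp_rw [this]
    have i1 : Integrable (fun x => κ ^ 2 * f x ^ 2 - 2 * κ * Z * f x) (μ.restrict K) :=
      (hf2.const_mul _).sub (hf.const_mul _)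
    rw [integral_add i1 (integrable_const _), integral_sub (hf2.const_mul _) (hf.const_mul _)]
    simp only [integral_const_mul, setIntegral_const, smul_eq_mul]
    change κ ^ 2 * _ - 2 * κ * Z * Z + κ * Z ^ 2 = _
    ring
  rw [e] at h
  rcases (measureReal_nonneg : 0 ≤ κ).eq_or_lt with h0 | h0
  · have : Z = 0 := by
      have h1 : μ K = 0 := by
        have := h0.symm
        rwa [measureReal_eq_zero_iff] at this
      simp only [Z, Measure.restrict_eq_zero.2 h1, integral_zero_measure]
    rw [this]; simp [κ, ← h0]
  · linarith [nonneg_of_mul_nonneg_right h h0]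

theorem map_inner_stdGaussian {n : ℕ} (v : EuclideanSpace ℝ (Fin n)) :
    (stdGaussian (EuclideanSpace ℝ (Fin n))).map (fun x => inner ℝ v x) =
      gaussianReal 0 (‖v‖ ^ 2).toNNReal := by
  have := IsGaussian.map_eq_gaussianReal (μ := stdGaussian (EuclideanSpace ℝ (Fin n)))
    (innerSL ℝ v)
  rw [integral_strongDual_stdGaussian, variance_dual_stdGaussian, innerSL_apply_norm] at this
  exact this

theorem integrable_pow_gaussianReal (p : ℕ) (σ : NNReal) :
    Integrable (fun t : ℝ => t ^ p) (gaussianReal 0 σ) := by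
  rcases eq_or_ne p 0 with rfl | hp
  · simp
  have h := (memLp_id_gaussianReal (μ := 0) (v := σ) (p : NNReal))
  have h2 := h.integrable_norm_rpow (by simpa using hp) (by simp)
  refine Integrable.mono' h2 (by fun_prop) (ae_of_all _ fun x => ?_)
  simp

theorem integrable_inner_pow_stdGaussian {n : ℕ} (v : EuclideanSpace ℝ (Fin n)) (p : ℕ) :
    Integrable (fun x => (inner ℝ v x : ℝ) ^ p) (stdGaussian (EuclideanSpace ℝ (Fin n))) := by
  have h := integrable_pow_gaussianReal p (‖v‖ ^ 2).toNNReal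
  rw [← map_inner_stdGaussian] at h
  exact h.comp_measurable (by fun_prop)

theorem integral_inner_pow_stdGaussian {n : ℕ} {v : EuclideanSpace ℝ (Fin n)} (hv : ‖v‖ = 1)
    (p : ℕ) : ∫ x, (inner ℝ v x : ℝ) ^ p ∂stdGaussian (EuclideanSpace ℝ (Fin n)) =
      ∫ t, t ^ p ∂gaussianReal 0 1 := by
  have h := map_inner_stdGaussian v
  rw [hv, one_pow, Real.toNNReal_one] at h
  rw [← h, integral_map (by fun_prop) (by fun_prop)]

/-- Truncation at height `L`, with a tail small enough to be controlled by the sixteenth Gaussian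
moment. -/
theorem abs_le_add_pow_div {t L : ℝ} (hL : 0 < L) : |t| ≤ L + t ^ 16 / L ^ 15 := by
  have h0 : 0 ≤ t ^ 16 / L ^ 15 := by positivity
  rcases le_or_gt |t| L with h | h
  · linarith
  · have : |t| ≤ t ^ 16 / L ^ 15 := by
      rw [le_div_iff₀ (by positivity)]
      calc |t| * L ^ 15 ≤ |t| * |t| ^ 15 := by gcongr
        _ = |t| ^ 16 := by ring
        _ = t ^ 16 := Even.pow_abs (by decide) t
    linarith

/-- If the restriction of the Gaussian measure to a convex set `K` has almost the same first two
moments as the Gaussian measure in a direction `v`, then a half-space containing `K` whose boundary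
is transversal to `v` has little mass of `K` near its boundary. -/
theorem setIntegral_exp_neg_le {n : ℕ} {K : Set (EuclideanSpace ℝ (Fin n))}
    (hK : IsClosed K) (hKc : Convex ℝ K) {v w : EuclideanSpace ℝ (Fin n)} (hv : ‖v‖ = 1)
    (hw : ‖w‖ = 1) {θ : ℝ} (hKw : ∀ x ∈ K, 0 ≤ inner ℝ w x + θ) {c s L δ D : ℝ}
    (hc : inner ℝ v w = c) (hc0 : 0 < c) (hs : 0 < s) (hL : 0 < L) (hsL : s * (1 + L) ≤ c / 4)
    (hδ : 0 < δ) (hδκ : δ ≤ (stdGaussian (EuclideanSpace ℝ (Fin n))).real K)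
    (hm1 : |∫ x in K, inner ℝ v x ∂stdGaussian (EuclideanSpace ℝ (Fin n))| ≤ δ)
    (hm2 : (stdGaussian (EuclideanSpace ℝ (Fin n))).real K -
      ∫ x in K, (inner ℝ v x) ^ 2 ∂stdGaussian (EuclideanSpace ℝ (Fin n)) ≤ D * δ) :
    ∫ x in K, Real.exp (-((inner ℝ w x + θ) / s)) ∂stdGaussian (EuclideanSpace ℝ (Fin n)) ≤
      2 * (1 + D) * δ / c ^ 2 + 2 * s * (∫ t, t ^ 16 ∂gaussianReal 0 1) / (c * L ^ 15) := by
  set γ := stdGaussian (EuclideanSpace ℝ (Fin n))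
  let X : EuclideanSpace ℝ (Fin n) → ℝ := fun x => inner ℝ v x
  let ζ : EuclideanSpace ℝ (Fin n) → ℝ := fun x => Real.exp (-((inner ℝ w x + θ) / s))
  -- With `τ / s = c / 2`, the squared gradient of `X + τ ζ` is `1 - c² ζ + (c² / 4) ζ²`; as `ζ² ≤
  -- ζ` on `K`, the linear gain dominates.
  set τ := c * s / 2 with hτ
  have hτ0 : 0 < τ := by positivity
  let G : EuclideanSpace ℝ (Fin n) → ℝ := fun x => ‖v - (τ / s * ζ x) • w‖
  have hXc : Continuous X := by fun_prop
  have hζc : Continuous ζ := by fun_prop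
  have hGc : Continuous G := by fun_prop
  have hζ0 : ∀ x, 0 ≤ ζ x := fun x => Real.exp_nonneg _
  have hζ1 : ∀ x ∈ K, ζ x ≤ 1 := fun x hx => Real.exp_le_one_iff.2
    (neg_nonpos.2 (div_nonneg (hKw x hx) hs.le))
  have hKm := hK.measurableSet
  have hiX : IntegrableOn X K γ := by
    have := (integrable_inner_pow_stdGaussian v 1).integrableOn (s := K)
    simpa using this
  have hiX2 : IntegrableOn (fun x => X x ^ 2) K γ :=
    (integrable_inner_pow_stdGaussian v 2).integrableOn
  have hbdd : ∀ f : EuclideanSpace ℝ (Fin n) → ℝ, Continuous f → (∀ x ∈ K, |f x| ≤ 1) →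
      IntegrableOn f K γ := by
    intro f hf hb
    refine IntegrableOn.of_bound (measure_lt_top _ _) hf.aestronglyMeasurable 1 ?_
    exact (ae_restrict_iff' hKm).2 (ae_of_all _ hb)
  have hiζ : IntegrableOn ζ K γ := hbdd ζ hζc fun x hx => by
    rw [abs_of_nonneg (hζ0 x)]; exact hζ1 x hx
  have hiζ2 : IntegrableOn (fun x => ζ x ^ 2) K γ := hbdd _ (by fun_prop) fun x hx => by
    rw [abs_of_nonneg (sq_nonneg _)]; exact pow_le_one₀ (hζ0 x) (hζ1 x hx)
  have hiXζ : IntegrableOn (fun x => X x * ζ x) K γ := by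
    refine Integrable.mono hiX (by fun_prop) ((ae_restrict_iff' hKm).2 (ae_of_all _ fun x hx => ?_))
    rw [norm_mul]
    refine mul_le_of_le_one_right (norm_nonneg _) ?_
    rw [Real.norm_of_nonneg (hζ0 x)]; exact hζ1 x hx
  set κ := γ.real K
  set m1 := ∫ x in K, X x ∂γ with hm1d
  set m2 := ∫ x in K, X x ^ 2 ∂γ with hm2d
  set Z := ∫ x in K, ζ x ∂γ with hZ
  set Z2 := ∫ x in K, ζ x ^ 2 ∂γ with hZ2
  set C := ∫ x in K, X x * ζ x ∂γ with hC
  set P := ∫ t, t ^ 16 ∂gaussianReal 0 1 with hP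
  change Z ≤ _
  have hZ0 : 0 ≤ Z := integral_nonneg hζ0
  have hκ0 : 0 < κ := hδ.trans_le hδκ
  have hG2 : ∀ x, G x ^ 2 = 1 - 2 * (τ / s * c) * ζ x + (τ / s) ^ 2 * ζ x ^ 2 := by
    intro x
    simp only [G]
    rw [norm_sub_sq_real, hv, norm_smul, hw, real_inner_smul_right, hc, mul_one, Real.norm_eq_abs,
      sq_abs]
    ring
  have hh2 : ∀ x, (X x + τ * ζ x) ^ 2 = X x ^ 2 + 2 * τ * (X x * ζ x) + τ ^ 2 * ζ x ^ 2 :=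
    fun x => by ring
  have hpoin := setIntegral_poincare hK hKc (h := fun x => X x + τ * ζ x) (G := G)
    (M := 2 * τ / s ^ 2) (by fun_prop) hGc (by positivity)
    (hiX.add (hiζ.const_mul _))
    (by simp_rw [hh2]; exact (hiX2.add (hiXζ.const_mul _)).add (hiζ2.const_mul _))
    (by
      simp_rw [hG2]
      exact ((integrable_const _).sub (hiζ.const_mul _)).add (hiζ2.const_mul _)) ?_
  · simp_rw [hG2, hh2] at hpoin
    have i1 : Integrable (fun x => X x ^ 2 + 2 * τ * (X x * ζ x)) (γ.restrict K) :=
      hiX2.add (hiXζ.const_mul _)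
    have i2 : Integrable (fun x => 1 - 2 * (τ / s * c) * ζ x) (γ.restrict K) :=
      (integrable_const _).sub (hiζ.const_mul _)
    rw [integral_add i1 (hiζ2.const_mul _),
      integral_add hiX2 (hiXζ.const_mul _), integral_add hiX (hiζ.const_mul _),
      integral_add i2 (hiζ2.const_mul _),
      integral_sub (integrable_const _) (hiζ.const_mul _)] at hpoin
    simp only [integral_const_mul, setIntegral_const, smul_eq_mul, mul_one] at hpoin
    change κ * (m2 + 2 * τ * C + τ ^ 2 * Z2) ≤ (m1 + τ * Z) ^ 2 +
      κ * (κ - 2 * (τ / s * c) * Z + (τ / s) ^ 2 * Z2) at hpoin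
    have hCS : Z ^ 2 ≤ κ * Z2 := sq_setIntegral_le hiζ hiζ2
    have hZ2Z : Z2 ≤ Z := setIntegral_mono_on hiζ2 hiζ hKm fun x hx => by
      nlinarith [hζ0 x, hζ1 x hx]
    have hiX16 := integrable_inner_pow_stdGaussian v 16
    have hCl : -C ≤ L * Z + P / L ^ 15 := by
      have h1 : ∫ x in K, -(X x * ζ x) ∂γ ≤ ∫ x in K, (L * ζ x + X x ^ 16 / L ^ 15) ∂γ := by
        refine setIntegral_mono_on hiXζ.neg
          ((hiζ.const_mul _).add (hiX16.integrableOn.div_const _)) hKm fun x hx => ?_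
        have h2 := abs_le_add_pow_div (t := X x) hL
        have h3 : 0 ≤ X x ^ 16 / L ^ 15 := by positivity
        have h4 := hζ0 x
        have h5 := hζ1 x hx
        calc -(X x * ζ x) ≤ |X x| * ζ x := by nlinarith [neg_abs_le (X x)]
          _ ≤ (L + X x ^ 16 / L ^ 15) * ζ x := by gcongr
          _ ≤ _ := by nlinarith
      rw [integral_neg, integral_add (hiζ.const_mul _) (hiX16.integrableOn.div_const _),
        integral_const_mul, integral_div] at h1
      have h6 : ∫ x in K, X x ^ 16 ∂γ ≤ P := by
        rw [hP, ← integral_inner_pow_stdGaussian hv 16]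
        exact setIntegral_le_integral hiX16 (ae_of_all _ fun x => by positivity)
      have : (∫ x in K, X x ^ 16 ∂γ) / L ^ 15 ≤ P / L ^ 15 := by gcongr
      linarith
    have e1 : τ / s = c / 2 := by rw [hτ]; field_simp
    rw [e1] at hpoin
    have hm1' : m1 ^ 2 ≤ δ * κ := by
      rw [← sq_abs]
      nlinarith [abs_nonneg m1]
    have hm1Z : m1 * Z ≤ κ * Z := by
      have := le_abs_self m1
      have : m1 ≤ κ := by linarith
      gcongr
    -- The term `τ² Z²` from the squared mean cancels against `τ² κ Z2` by Cauchy–Schwarz. Below,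
    -- `hsL` bounds `2 τ (1 + L) Z` by `c² Z / 4`, so half of `c² Z` survives.
    have h1 : κ * (c ^ 2 * Z) ≤ κ * ((1 + D) * δ + 2 * τ * (Z + L * Z + P / L ^ 15) + c ^ 2 / 4 * Z) := by
      have a1 : κ * (κ - m2) ≤ κ * (D * δ) := by gcongr
      have a2 : τ ^ 2 * Z ^ 2 ≤ τ ^ 2 * (κ * Z2) := by gcongr
      have a3 : 2 * τ * (m1 * Z) ≤ 2 * τ * (κ * Z) := by gcongr
      have a4 : κ * (2 * τ) * (-C) ≤ κ * (2 * τ) * (L * Z + P / L ^ 15) := by gcongr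
      have a5 : κ * (c ^ 2 / 4) * Z2 ≤ κ * (c ^ 2 / 4) * Z := by gcongr
      linarith
    have h2 := le_of_mul_le_mul_left h1 hκ0
    have h3 : 2 * τ * (Z + L * Z) ≤ c ^ 2 / 4 * Z := by
      have : c * (s * (1 + L)) * Z ≤ c * (c / 4) * Z := by gcongr
      rw [hτ]; linarith
    have h4 : c ^ 2 * Z ≤ 2 * (1 + D) * δ + 2 * (c * s) * (P / L ^ 15) := by
      rw [hτ] at h2 h3; linarith
    have h5 : 2 * (1 + D) * δ / c ^ 2 + 2 * s * P / (c * L ^ 15) =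
        (2 * (1 + D) * δ + 2 * (c * s) * (P / L ^ 15)) / c ^ 2 := by
      field_simp
    rw [h5, le_div_iff₀ (by positivity)]
    linarith
  · intro z d h1 h2
    have h3 : z ∈ K := by
      have := hKc h1 h2 (a := 1 / 2) (b := 1 / 2) (by norm_num) (by norm_num) (by norm_num)
      convert this using 1
      module
    set a := (inner ℝ w d : ℝ) / s with ha
    set t := (inner ℝ w z + θ) / s with ht
    have ht0 : 0 ≤ t := div_nonneg (hKw z h3) hs.le
    have e1 : (inner ℝ w (z + d) + θ) / s = t + a := by rw [inner_add_right, ht, ha]; ring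
    have e2 : (inner ℝ w (z - d) + θ) / s = t + -a := by rw [inner_sub_right, ht, ha]; ring
    have b1 := Real.exp_neg_add_taylor ht0 (e1 ▸ div_nonneg (hKw _ h1) hs.le)
    have b2 := Real.exp_neg_add_taylor ht0 (e2 ▸ div_nonneg (hKw _ h2) hs.le)
    have hζz : ζ z = Real.exp (-t) := rfl
    have hζ1' : ζ (z + d) = Real.exp (-(t + a)) := by simp only [ζ, e1]
    have hζ2' : ζ (z - d) = Real.exp (-(t + -a)) := by simp only [ζ, e2]
    have hX : X (z + d) - X (z - d) = 2 * inner ℝ v d := by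
      simp only [X, inner_add_right, inner_sub_right]; ring
    have hcs : inner ℝ (v - (τ / s * ζ z) • w) d ≤ G z * ‖d‖ := real_inner_le_norm _ _
    rw [inner_sub_left, real_inner_smul_left] at hcs
    have hda : τ / s * ζ z * inner ℝ w d = τ * ζ z * a := by rw [ha]; ring
    rw [hda] at hcs
    have ha2 : a ^ 2 ≤ ‖d‖ ^ 2 / s ^ 2 := by
      rw [ha, div_pow]
      have := abs_real_inner_le_norm w d
      rw [hw, one_mul] at this
      have h5 : (inner ℝ w d : ℝ) ^ 2 ≤ ‖d‖ ^ 2 := by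
        rw [← sq_abs]; exact pow_le_pow_left₀ (abs_nonneg _) this 2
      gcongr
    have h6 : ζ (z + d) - ζ (z - d) ≤ -2 * a * ζ z + a ^ 2 := by
      rw [hζ1', hζ2', hζz]; linarith [b1.2, b2.1]
    have h7 : τ * (ζ (z + d) - ζ (z - d)) ≤ τ * (-2 * a * ζ z + ‖d‖ ^ 2 / s ^ 2) := by
      gcongr; linarith
    have h8 : 0 ≤ τ * (‖d‖ ^ 2 / s ^ 2) := by positivity
    have h9 : 2 * τ / s ^ 2 * ‖d‖ ^ 2 = 2 * (τ * (‖d‖ ^ 2 / s ^ 2)) := by ring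
    change X (z + d) + τ * ζ (z + d) - (X (z - d) + τ * ζ (z - d)) ≤ _
    rw [h9]
    linarith

/-! ### Dropping half-spaces -/

/-- Cutting a convex set `K` by a set `A` in such a way that little mass of `K ∩ A` is near the
boundary of `A` removes little mass. -/
theorem measureReal_sub_measureReal_inter_mul_le {n : ℕ} {K A : Set (EuclideanSpace ℝ (Fin n))}
    (hK : IsClosed K) (hKc : Convex ℝ K) (hA : MeasurableSet A) {s : ℝ} (hs : 0 < s)
    (hY : ∫ x in K ∩ A, Real.exp (-(Metric.infDist x Aᶜ / s))
      ∂stdGaussian (EuclideanSpace ℝ (Fin n)) ≤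
        (stdGaussian (EuclideanSpace ℝ (Fin n))).real (K ∩ A) / 4) :
    ((stdGaussian (EuclideanSpace ℝ (Fin n))).real K -
        (stdGaussian (EuclideanSpace ℝ (Fin n))).real (K ∩ A)) *
      (stdGaussian (EuclideanSpace ℝ (Fin n))).real (K ∩ A) ≤
      16 / s ^ 2 * ∫ x in K ∩ A, Real.exp (-(Metric.infDist x Aᶜ / s))
      ∂stdGaussian (EuclideanSpace ℝ (Fin n)) := by
  set γ := stdGaussian (EuclideanSpace ℝ (Fin n))
  let e : EuclideanSpace ℝ (Fin n) → ℝ := fun x => Real.exp (-(Metric.infDist x Aᶜ / s))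
  have hec : Continuous e := by
    have := Metric.continuous_infDist_pt (Aᶜ : Set (EuclideanSpace ℝ (Fin n)))
    fun_prop
  have he0 : ∀ x, 0 ≤ e x := fun x => Real.exp_nonneg _
  have hm0 : ∀ x, 0 ≤ Metric.infDist x Aᶜ / s := fun x => div_nonneg Metric.infDist_nonneg hs.le
  have he1 : ∀ x, e x ≤ 1 := fun x => Real.exp_le_one_iff.2 (neg_nonpos.2 (hm0 x))
  have heA : ∀ x, x ∉ A → e x = 1 := fun x hx => by
    simp only [e]
    rw [Metric.infDist_zero_of_mem (by simpa using hx)]; simp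
  have hint : ∀ (f : EuclideanSpace ℝ (Fin n) → ℝ) (S : Set _), Continuous f →
      (∃ B, ∀ x, |f x| ≤ B) → IntegrableOn f S γ := by
    intro f S hf ⟨B, hb⟩
    exact IntegrableOn.of_bound (measure_lt_top _ _) hf.aestronglyMeasurable B (ae_of_all _ hb)
  have hKm := hK.measurableSet
  have hKAm := hKm.inter hA
  -- Squaring removes the kink of `1 - e` at the boundary of `A`: the gradient bound `G` is
  -- continuous, vanishes off `A`, and leaves only a quadratic error.
  let φ : EuclideanSpace ℝ (Fin n) → ℝ := fun x => (1 - e x) ^ 2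
  let G : EuclideanSpace ℝ (Fin n) → ℝ := fun x => 2 / s * ((1 - e x) * e x)
  have hφ0 : ∀ x, 0 ≤ φ x := fun x => sq_nonneg _
  have hφ1 : ∀ x, φ x ≤ 1 := fun x =>
    pow_le_one₀ (by linarith [he1 x]) (by linarith [he0 x])
  have hφA : ∀ x, x ∉ A → φ x = 0 := fun x hx => by simp [φ, heA x hx]
  have hGA : ∀ x, x ∉ A → G x = 0 := fun x hx => by simp [G, heA x hx]
  have hge : ∀ x, (1 - e x) * e x ≤ e x := fun x => by nlinarith [he0 x]
  have hge0 : ∀ x, 0 ≤ (1 - e x) * e x := fun x => mul_nonneg (by linarith [he1 x]) (he0 x)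
  have hG0 : ∀ x, 0 ≤ G x := fun x => mul_nonneg (by positivity) (hge0 x)
  have hG2 : ∀ x, G x ^ 2 ≤ 4 / s ^ 2 * e x := fun x => by
    have h1 : ((1 - e x) * e x) ^ 2 ≤ e x ^ 2 := pow_le_pow_left₀ (hge0 x) (hge x) 2
    have h2 : e x ^ 2 ≤ e x := by nlinarith [he0 x, he1 x]
    calc G x ^ 2 = 4 / s ^ 2 * ((1 - e x) * e x) ^ 2 := by simp only [G]; ring
      _ ≤ 4 / s ^ 2 * e x := by gcongr; linarith
  have hiφ : ∀ S, IntegrableOn φ S γ := fun S => hint φ S (by fun_prop)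
    ⟨1, fun x => by rw [abs_of_nonneg (hφ0 x)]; exact hφ1 x⟩
  have hiφ2 : ∀ S, IntegrableOn (fun x => φ x ^ 2) S γ := fun S => hint _ S (by fun_prop)
    ⟨1, fun x => by rw [abs_of_nonneg (sq_nonneg _)]; exact pow_le_one₀ (hφ0 x) (hφ1 x)⟩
  have hiG2 : ∀ S, IntegrableOn (fun x => G x ^ 2) S γ := fun S => hint _ S (by fun_prop)
    ⟨4 / s ^ 2, fun x => by
      rw [abs_of_nonneg (sq_nonneg _)]
      exact (hG2 x).trans (mul_le_of_le_one_right (by positivity) (he1 x))⟩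
  have hie : ∀ S, IntegrableOn e S γ := fun S => hint e S hec
    ⟨1, fun x => by rw [abs_of_nonneg (he0 x)]; exact he1 x⟩
  have hpoin := setIntegral_poincare hK hKc (h := φ) (G := G) (M := 6 / s ^ 2) (by fun_prop)
    (by fun_prop) (by positivity) (hiφ K) (hiφ2 K) (hiG2 K) ?_
  · have hrestr : ∀ f : EuclideanSpace ℝ (Fin n) → ℝ, (∀ x, x ∉ A → f x = 0) →
        ∫ x in K, f x ∂γ = ∫ x in K ∩ A, f x ∂γ := fun f hf =>
      setIntegral_eq_of_subset_of_forall_sdiff_eq_zero hKm Set.inter_subset_left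
        fun x hx => hf x fun h => hx.2 ⟨hx.1, h⟩
    rw [hrestr φ hφA, hrestr (fun x => φ x ^ 2) fun x hx => by rw [hφA x hx]; simp,
      hrestr (fun x => G x ^ 2) fun x hx => by rw [hGA x hx]; simp] at hpoin
    have hCS := sq_setIntegral_le (hiφ (K ∩ A)) (hiφ2 (K ∩ A))
    have hGY : ∫ x in K ∩ A, G x ^ 2 ∂γ ≤ 4 / s ^ 2 * ∫ x in K ∩ A, e x ∂γ := by
      rw [← integral_const_mul]
      exact setIntegral_mono (hiG2 _) ((hie _).const_mul _) hG2
    have hΦ : γ.real (K ∩ A) - 2 * ∫ x in K ∩ A, e x ∂γ ≤ ∫ x in K ∩ A, φ x ∂γ := by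
      have : ∫ x in K ∩ A, (1 - 2 * e x) ∂γ ≤ ∫ x in K ∩ A, φ x ∂γ :=
        setIntegral_mono ((integrable_const _).sub ((hie _).const_mul _)) (hiφ _) fun x => by
          simp only [φ]; nlinarith [sq_nonneg (e x)]
      rw [integral_sub (integrable_const _) ((hie _).const_mul _)] at this
      simpa [integral_const_mul] using this
    have hle : γ.real (K ∩ A) ≤ γ.real K := measureReal_mono Set.inter_subset_left
    have hK1 : γ.real K ≤ 1 := measureReal_le_one
    have hκ0 : 0 ≤ γ.real (K ∩ A) := measureReal_nonneg
    have hY0 : 0 ≤ ∫ x in K ∩ A, e x ∂γ := integral_nonneg he0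
    change ∫ x in K ∩ A, e x ∂γ ≤ γ.real (K ∩ A) / 4 at hY
    change _ ≤ 16 / s ^ 2 * ∫ x in K ∩ A, e x ∂γ
    set κ₀ := γ.real K
    set κ := γ.real (K ∩ A)
    set Y := ∫ x in K ∩ A, e x ∂γ
    set Φ := ∫ x in K ∩ A, φ x ∂γ
    have hR : 0 ≤ 4 / s ^ 2 * Y := by positivity
    have h16 : 16 / s ^ 2 * Y = 4 * (4 / s ^ 2 * Y) := by ring
    rw [h16]
    set R := 4 / s ^ 2 * Y
    rcases hκ0.eq_or_lt with h0 | h0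
    · rw [← h0]; linarith
    -- As `φ` lives on `K ∩ A`, Cauchy–Schwarz gives `Φ² ≤ κ ∫ φ²`; Poincaré on all of `K` bounds
    -- `κ₀ ∫ φ²`. Hence `(κ₀ - κ) Φ² ≤ κ κ₀ R`, while `Φ ≥ κ / 2`.
    have h1 : κ₀ * Φ ^ 2 ≤ κ * (Φ ^ 2 + κ₀ * R) := by
      calc κ₀ * Φ ^ 2 ≤ κ₀ * (κ * ∫ x in K ∩ A, φ x ^ 2 ∂γ) :=
            mul_le_mul_of_nonneg_left hCS (by linarith)
        _ = κ * (κ₀ * ∫ x in K ∩ A, φ x ^ 2 ∂γ) := by ring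
        _ ≤ κ * (Φ ^ 2 + κ₀ * ∫ x in K ∩ A, G x ^ 2 ∂γ) := by gcongr
        _ ≤ κ * (Φ ^ 2 + κ₀ * R) := by gcongr
    have h2 : κ ^ 2 / 4 ≤ Φ ^ 2 := by
      have : κ / 2 ≤ Φ := by linarith
      nlinarith
    have h3 : (κ₀ - κ) * (κ ^ 2 / 4) ≤ (κ₀ - κ) * Φ ^ 2 :=
      mul_le_mul_of_nonneg_left h2 (by linarith)
    have h4 : κ * (κ₀ * R) ≤ κ * (1 * R) := by gcongr
    have h5 : κ * ((κ₀ - κ) * κ) ≤ κ * (4 * R) := by linarith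
    exact le_of_mul_le_mul_left h5 h0
  · intro z d _ _
    set m := fun x : EuclideanSpace ℝ (Fin n) => Metric.infDist x Aᶜ
    have hLip : ∀ x y, |m x - m y| ≤ ‖x - y‖ := fun x y => by
      have := (Metric.lipschitz_infDist_pt (Aᶜ : Set (EuclideanSpace ℝ (Fin n)))).dist_le_mul x y
      simpa [Real.dist_eq, dist_eq_norm] using this
    set t := m z / s with ht
    set a := (m (z + d) - m z) / s with ha
    set b := (m (z - d) - m z) / s with hb
    have ht0 : 0 ≤ t := hm0 z
    have hta : m (z + d) / s = t + a := by rw [ht, ha]; ring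
    have htb : m (z - d) / s = t + b := by rw [ht, hb]; ring
    have hta0 : 0 ≤ t + a := hta ▸ hm0 (z + d)
    have htb0 : 0 ≤ t + b := htb ▸ hm0 (z - d)
    have ha2 : a ^ 2 ≤ ‖d‖ ^ 2 / s ^ 2 := by
      have := hLip (z + d) z
      rw [add_sub_cancel_left] at this
      rw [ha, div_pow, ← sq_abs (m (z + d) - m z)]
      gcongr
    have hb2 : b ^ 2 ≤ ‖d‖ ^ 2 / s ^ 2 := by
      have := hLip (z - d) z
      rw [sub_sub_cancel_left, norm_neg] at this
      rw [hb, div_pow, ← sq_abs (m (z - d) - m z)]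
      gcongr
    have hab : a - b ≤ 2 / s * ‖d‖ := by
      have h1 := (le_abs_self _).trans (hLip (z + d) (z - d))
      have h2 : ‖z + d - (z - d)‖ = 2 * ‖d‖ := by
        rw [show z + d - (z - d) = (2 : ℝ) • d by module, norm_smul]; norm_num
      rw [h2] at h1
      have h3 : a - b = (m (z + d) - m (z - d)) / s := by rw [ha, hb]; ring
      rw [h3, div_mul_eq_mul_div]
      gcongr
    have e1 : e (z + d) = Real.exp (-(t + a)) := by rw [← hta]
    have e2 : e (z - d) = Real.exp (-(t + b)) := by rw [← htb]
    have e0 : e z = Real.exp (-t) := rfl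
    have sqe : ∀ r : ℝ, Real.exp (-r) ^ 2 = Real.exp (-(2 * r)) := fun r => by
      rw [← Real.exp_nat_mul]; congr 1; push_cast; ring
    have s1 : e (z + d) ^ 2 = Real.exp (-(2 * t + 2 * a)) := by rw [e1, sqe]; congr 1; ring
    have s2 : e (z - d) ^ 2 = Real.exp (-(2 * t + 2 * b)) := by rw [e2, sqe]; congr 1; ring
    have s0 : e z ^ 2 = Real.exp (-(2 * t)) := by rw [e0, sqe]
    have t1 := Real.exp_neg_add_taylor ht0 hta0
    have t2 := Real.exp_neg_add_taylor ht0 htb0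
    have t3 := Real.exp_neg_add_taylor (t := 2 * t) (a := 2 * a) (by linarith) (by linarith)
    have t4 := Real.exp_neg_add_taylor (t := 2 * t) (a := 2 * b) (by linarith) (by linarith)
    rw [← e0, ← e1] at t1
    rw [← e0, ← e2] at t2
    rw [← s0, ← s1] at t3
    rw [← s0, ← s2] at t4
    have hfin : φ (z + d) - φ (z - d) ≤ 2 * (a - b) * ((1 - e z) * e z) + 4 * a ^ 2 + 2 * b ^ 2 := by
      simp only [φ]
      linarith [t1.1, t2.2, t3.2, t4.1]
    have h1 : 2 * (a - b) * ((1 - e z) * e z) ≤ 2 * (2 / s * ‖d‖) * ((1 - e z) * e z) := by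
      have := hge0 z
      gcongr
    have h2 : 2 * G z * ‖d‖ = 2 * (2 / s * ‖d‖) * ((1 - e z) * e z) := by simp only [G]; ring
    have h3 : 6 / s ^ 2 * ‖d‖ ^ 2 = 6 * (‖d‖ ^ 2 / s ^ 2) := by ring
    rw [h2, h3]
    linarith

/-! ### Perturbing the normal of a half-space -/

theorem gaussianReal_le_volume {σ : NNReal} (hσ : (1 : ℝ) / 4 ≤ σ) (μ : ℝ) (S : Set ℝ) :
    gaussianReal μ σ S ≤ volume S := by
  have h0 : σ ≠ 0 := by rintro rfl; norm_num at hσ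
  rw [gaussianReal_apply _ h0]
  calc ∫⁻ x in S, gaussianPDF μ σ x ≤ ∫⁻ x in S, 1 := by
        refine lintegral_mono fun x => ?_
        rw [gaussianPDF, ENNReal.ofReal_le_one, gaussianPDFReal]
        refine mul_le_one₀ (inv_le_one_of_one_le₀ ?_) (by positivity) (Real.exp_le_one_iff.2 ?_)
        · rw [Real.one_le_sqrt]; nlinarith [Real.pi_gt_three]
        · have := sq_nonneg (x - μ)
          rw [neg_div]
          exact neg_nonpos.2 (by positivity)
    _ = volume S := by simp

theorem integral_inner_sq_stdGaussian {n : ℕ} (v : EuclideanSpace ℝ (Fin n)) :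
    ∫ x, (inner ℝ v x : ℝ) ^ 2 ∂stdGaussian (EuclideanSpace ℝ (Fin n)) = ‖v‖ ^ 2 := by
  have h := variance_dual_stdGaussian (E := EuclideanSpace ℝ (Fin n)) (innerSL ℝ v)
  rw [variance_of_integral_eq_zero (by fun_prop) (integral_strongDual_stdGaussian _),
    innerSL_apply_norm] at h
  exact h

/-- Two half-spaces with nearby normal vectors and equal offsets differ in a set of small Gaussian
measure. -/
theorem measureReal_halfspace_symmDiff_le {n : ℕ} {w u : EuclideanSpace ℝ (Fin n)}
    (hu : 1 / 2 ≤ ‖u‖) {c T : ℝ} (hc : 0 < c) (hT : 0 < T) (hwu : ‖w - u‖ ≤ c) (θ : ℝ) :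
    (stdGaussian (EuclideanSpace ℝ (Fin n))).real
      {x | ¬(0 ≤ inner ℝ w x + θ ↔ 0 ≤ inner ℝ u x + θ)} ≤ 2 * c * T + 1 / T ^ 2 := by
  set γ := stdGaussian (EuclideanSpace ℝ (Fin n))
  -- If the two signs differ, then either `u · x` is within `c T` of `-θ`, which is rare because its
  -- density is at most 1, or `|(w - u) · x| ≥ c T`, which is rare by Chebyshev.
  have hsub : {x : EuclideanSpace ℝ (Fin n) | ¬(0 ≤ inner ℝ w x + θ ↔ 0 ≤ inner ℝ u x + θ)} ⊆
      (fun x => inner ℝ u x) ⁻¹' Set.Icc (-θ - c * T) (-θ + c * T) ∪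
        {x | (c * T) ^ 2 ≤ (inner ℝ (w - u) x) ^ 2} := by
    intro x hx
    by_contra hcon
    simp only [Set.mem_union, Set.mem_preimage, Set.mem_Icc, Set.mem_ofPred_eq, not_or, not_and_or,
      not_le] at hcon hx
    have h2 := abs_lt_of_sq_lt_sq hcon.2 (by positivity)
    rw [inner_sub_left, abs_lt] at h2
    apply hx
    rcases hcon.1 with h1 | h1 <;> constructor <;> intro h <;> linarith
  refine (measureReal_mono hsub).trans ((measureReal_union_le _ _).trans (add_le_add ?_ ?_))
  · have hm : Measurable fun x : EuclideanSpace ℝ (Fin n) => (inner ℝ u x : ℝ) := by fun_prop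
    rw [measureReal_def, ← Measure.map_apply hm measurableSet_Icc, map_inner_stdGaussian]
    have h1 : (1 : ℝ) / 4 ≤ ((‖u‖ ^ 2).toNNReal : ℝ) := by
      rw [Real.coe_toNNReal _ (by positivity)]; nlinarith
    refine (ENNReal.toReal_mono (by simp) (gaussianReal_le_volume h1 0 _)).trans ?_
    rw [Real.volume_Icc, ENNReal.toReal_ofReal (by nlinarith [mul_pos hc hT])]
    linarith
  · have h1 := mul_meas_ge_le_integral_of_nonneg (μ := γ) (ae_of_all _ fun x => sq_nonneg _)
      (integrable_inner_pow_stdGaussian (w - u) 2) ((c * T) ^ 2)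
    rw [integral_inner_sq_stdGaussian] at h1
    rw [le_div_iff₀ (by positivity)]
    have h2 : ‖w - u‖ ^ 2 ≤ c ^ 2 := by gcongr
    have h3 := h1.trans h2
    have hc2 : 0 < c ^ 2 := by positivity
    refine le_of_mul_le_mul_left ?_ hc2
    calc c ^ 2 * (γ.real _ * T ^ 2) = (c * T) ^ 2 * γ.real _ := by ring
      _ ≤ c ^ 2 := h3
      _ = _ := by ring

/-! ### The two test polynomials -/

theorem integral_sq_sub_one_sq_gaussianReal_pos :
    0 < ∫ t : ℝ, (t ^ 2 - 1) ^ 2 ∂gaussianReal 0 1 := by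
  have hi : Integrable (fun t : ℝ => (t ^ 2 - 1) ^ 2) (gaussianReal 0 1) := by
    have h := ((integrable_pow_gaussianReal 4 1).sub
      ((integrable_pow_gaussianReal 2 1).const_mul 2)).add (integrable_const (1 : ℝ))
    refine h.congr (ae_of_all _ fun t => ?_)
    simp only [Pi.add_apply, Pi.sub_apply]; ring
  rw [integral_pos_iff_support_of_nonneg (fun t => sq_nonneg _) hi]
  have := nullSingletonClass_gaussianReal (μ := 0) (v := 1) one_ne_zero
  have hnull : gaussianReal 0 1 ({1, -1} : Set ℝ) = 0 := (Set.toFinite _).measure_zero _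
  rw [pos_iff_ne_zero]
  intro h0
  have : gaussianReal 0 1 Set.univ = 0 := by
    refine measure_mono_null (fun t _ => ?_) (measure_union_null h0 hnull)
    by_cases ht : (t ^ 2 - 1) ^ 2 = 0
    · right
      have h1 : t ^ 2 = 1 ^ 2 := by linarith [(pow_eq_zero_iff two_ne_zero).1 ht]
      simpa using sq_eq_sq_iff_eq_or_eq_neg.1 h1
    · left; exact ht
  simp at this

theorem isNormalizedMeanZeroQuadratic_X : IsNormalizedMeanZeroQuadratic Polynomial.X := by
  refine ⟨by simp, by simp [integral_id_gaussianReal], ?_⟩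
  have h := variance_fun_id_gaussianReal (μ := 0) (v := 1)
  rw [variance_of_integral_eq_zero (by fun_prop) (by simp)] at h
  simpa using h

theorem integral_sq_gaussianReal : ∫ t : ℝ, t ^ 2 ∂gaussianReal 0 1 = 1 := by
  simpa using isNormalizedMeanZeroQuadratic_X.2.2

theorem isNormalizedMeanZeroQuadratic_sq_sub_one :
    IsNormalizedMeanZeroQuadratic
      (Polynomial.C (Real.sqrt (∫ t : ℝ, (t ^ 2 - 1) ^ 2 ∂gaussianReal 0 1))⁻¹ *
        (Polynomial.X ^ 2 - 1)) := by
  have hpos := integral_sq_sub_one_sq_gaussianReal_pos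
  set D := ∫ t : ℝ, (t ^ 2 - 1) ^ 2 ∂gaussianReal 0 1 with hD
  refine ⟨?_, ?_, ?_⟩
  · refine (Polynomial.natDegree_C_mul_le _ _).trans ?_
    compute_degree
  · simp only [Polynomial.eval_mul, Polynomial.eval_C, Polynomial.eval_sub, Polynomial.eval_pow,
      Polynomial.eval_X, Polynomial.eval_one]
    rw [integral_const_mul, integral_sub (integrable_pow_gaussianReal 2 1) (integrable_const _),
      integral_sq_gaussianReal]
    simp
  · simp only [Polynomial.eval_mul, Polynomial.eval_C, Polynomial.eval_sub, Polynomial.eval_pow,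
      Polynomial.eval_X, Polynomial.eval_one, mul_pow]
    rw [integral_const_mul, ← hD, inv_pow, Real.sq_sqrt hpos.le, inv_mul_cancel₀ hpos.ne']

/-! ### Threshold functions as half-spaces -/

theorem IsLTF.exists_unit_or_zero {n : ℕ} {h : EuclideanSpace ℝ (Fin n) → ℝ} (hh : IsLTF h) :
    ∃ (w : EuclideanSpace ℝ (Fin n)) (θ : ℝ), (w = 0 ∨ ‖w‖ = 1) ∧
      ∀ x, h x = 1 ↔ 0 ≤ inner ℝ w x + θ := by
  obtain ⟨w, θ, hw⟩ := hh
  have h1 : ∀ x, h x = 1 ↔ 0 ≤ inner ℝ w x + θ := by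
    intro x
    rw [hw x]
    split_ifs with h0
    · simpa using h0
    · simp only [h0, iff_false]; norm_num
  rcases eq_or_ne w 0 with h0 | h0
  · exact ⟨w, θ, Or.inl h0, h1⟩
  · have hn : 0 < ‖w‖ := norm_pos_iff.2 h0
    refine ⟨‖w‖⁻¹ • w, ‖w‖⁻¹ * θ, Or.inr ?_, fun x => ?_⟩
    · rw [norm_smul, norm_inv, norm_norm, inv_mul_cancel₀ hn.ne']
    · rw [h1, real_inner_smul_left, ← mul_add]
      exact (mul_nonneg_iff_of_pos_left (inv_pos.2 hn)).symm

theorem isIntersectionOfLTFs_of_forall {n k : ℕ} {g : EuclideanSpace ℝ (Fin n) → ℝ}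
    (w : Fin k → EuclideanSpace ℝ (Fin n)) (θ : Fin k → ℝ)
    (hg : ∀ x, g x = {x | ∀ j, 0 ≤ inner ℝ (w j) x + θ j}.indicator 1 x) :
    IsIntersectionOfLTFs k g := by
  classical
  refine ⟨fun j x => if 0 ≤ inner ℝ (w j) x + θ j then 1 else -1,
    fun j => ⟨w j, θ j, fun x => rfl⟩, fun x => ?_⟩
  rw [hg x, Set.indicator_apply]
  have : (x ∈ {x | ∀ j, 0 ≤ inner ℝ (w j) x + θ j}) ↔
      ∀ j, (if 0 ≤ inner ℝ (w j) x + θ j then (1 : ℝ) else -1) = 1 := by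
    refine forall_congr' fun j => ?_
    split_ifs with h0
    · simpa using h0
    · simp only [h0]; norm_num
  simp only [this, Pi.one_apply]

theorem isIntersectionOfLTFs_zero {n k : ℕ} (hk : 0 < k) :
    IsIntersectionOfLTFs k fun _ : EuclideanSpace ℝ (Fin n) => (0 : ℝ) := by
  refine isIntersectionOfLTFs_of_forall (fun _ => 0) (fun _ => -1) fun x => ?_
  rw [Set.indicator_of_notMem]
  intro h
  have := h ⟨0, hk⟩
  norm_num at this

theorem IsIntersectionOfLTFs.exists_halfspaces {n k : ℕ} {f : EuclideanSpace ℝ (Fin n) → ℝ}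
    (hf : IsIntersectionOfLTFs k f) :
    ∃ (w : Fin k → EuclideanSpace ℝ (Fin n)) (θ : Fin k → ℝ), (∀ j, w j = 0 ∨ ‖w j‖ = 1) ∧
      f = {x | ∀ j, 0 ≤ inner ℝ (w j) x + θ j}.indicator 1 := by
  obtain ⟨h, hh, hfx⟩ := hf
  choose w θ hw hwx using fun j => (hh j).exists_unit_or_zero
  refine ⟨w, θ, hw, ?_⟩
  ext x
  rw [hfx, Set.indicator_apply]
  simp only [hwx, Pi.one_apply]
  rfl

theorem isClosed_setOf_forall_mem_halfspace {n : ℕ} {ι : Type*} (S : Set ι)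
    (w : ι → EuclideanSpace ℝ (Fin n)) (θ : ι → ℝ) :
    IsClosed {x | ∀ j ∈ S, 0 ≤ inner ℝ (w j) x + θ j} := by
  simp only [Set.ofPred_forall]
  exact isClosed_biInter fun j _ => isClosed_le continuous_const (by fun_prop)

theorem convex_setOf_forall_mem_halfspace {n : ℕ} {ι : Type*} (S : Set ι)
    (w : ι → EuclideanSpace ℝ (Fin n)) (θ : ι → ℝ) :
    Convex ℝ {x | ∀ j ∈ S, 0 ≤ inner ℝ (w j) x + θ j} := by
  intro x hx y hy a b ha hb hab j hj
  have h1 := mul_nonneg ha (hx j hj)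
  have h2 := mul_nonneg hb (hy j hj)
  rw [inner_add_right, real_inner_smul_right, real_inner_smul_right]
  have : θ j = a * θ j + b * θ j := by rw [← add_mul, hab, one_mul]
  linarith

/-- Inside an intersection of half-spaces with unit normal vectors, the distance to the complement
is at least the distance to one of the bounding hyperplanes. -/
theorem exp_neg_infDist_le_sum {n : ℕ} {ι : Type*} (S : Finset ι) (hS : S.Nonempty)
    (w : ι → EuclideanSpace ℝ (Fin n)) (hw : ∀ j ∈ S, ‖w j‖ = 1) (θ : ι → ℝ) {s : ℝ} (hs : 0 < s)
    (x : EuclideanSpace ℝ (Fin n)) :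
    Real.exp (-(Metric.infDist x {x | ∀ j ∈ S, 0 ≤ inner ℝ (w j) x + θ j}ᶜ / s)) ≤
      ∑ j ∈ S, Real.exp (-((inner ℝ (w j) x + θ j) / s)) := by
  -- Needed because `Metric.infDist` to the empty set is 0 by convention.
  have hne : ({x | ∀ j ∈ S, 0 ≤ inner ℝ (w j) x + θ j}ᶜ : Set (EuclideanSpace ℝ (Fin n))).Nonempty := by
    obtain ⟨i, hi⟩ := hS
    refine ⟨(-θ i - 1) • w i, fun h => ?_⟩
    have := h i hi
    rw [real_inner_smul_right, real_inner_self_eq_norm_sq, hw i hi] at this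
    linarith
  obtain ⟨i, hi, hmin⟩ := S.exists_min_image (fun j => inner ℝ (w j) x + θ j) hS
  have hle : inner ℝ (w i) x + θ i ≤
      Metric.infDist x {x | ∀ j ∈ S, 0 ≤ inner ℝ (w j) x + θ j}ᶜ := by
    refine (Metric.le_infDist hne).2 fun y hy => ?_
    simp only [Set.mem_compl_iff, Set.mem_ofPred_eq, not_forall, not_le] at hy
    obtain ⟨j, hj, hy⟩ := hy
    have h1 := real_inner_le_norm (w j) (x - y)
    rw [hw j hj, one_mul, inner_sub_right, ← dist_eq_norm] at h1
    linarith [hmin j hj]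
  refine le_trans (Real.exp_le_exp.2 ?_)
    (Finset.single_le_sum (f := fun j => Real.exp (-((inner ℝ (w j) x + θ j) / s)))
      (fun j _ => Real.exp_nonneg _) hi)
  have : (inner ℝ (w i) x + θ i) / s ≤
      Metric.infDist x {x | ∀ j ∈ S, 0 ≤ inner ℝ (w j) x + θ j}ᶜ / s := by gcongr
  linarith

theorem integral_abs_sub_indicator_le {n : ℕ} {A B U : Set (EuclideanSpace ℝ (Fin n))}
    (hU : ∀ x, x ∉ U → (x ∈ A ↔ x ∈ B)) :
    ∫ x, |A.indicator 1 x - B.indicator 1 x| ∂stdGaussian (EuclideanSpace ℝ (Fin n)) ≤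
      (stdGaussian (EuclideanSpace ℝ (Fin n))).real U := by
  set γ := stdGaussian (EuclideanSpace ℝ (Fin n))
  have hm := measurableSet_toMeasurable γ U
  have h1 : ∫ x, |A.indicator 1 x - B.indicator 1 x| ∂γ ≤
      ∫ x, (toMeasurable γ U).indicator (fun _ => (1 : ℝ)) x ∂γ := by
    refine integral_mono_of_nonneg (ae_of_all _ fun x => abs_nonneg _)
      ((integrable_const (1 : ℝ)).indicator hm) (ae_of_all _ fun x => ?_)
    by_cases hx : x ∈ toMeasurable γ U
    · by_cases hA : x ∈ A <;> by_cases hB : x ∈ B <;> simp [hx, hA, hB]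
    · have := hU x fun h => hx (subset_toMeasurable _ _ h)
      by_cases hA : x ∈ A
      · simp [hx, hA, this.1 hA]
      · simp [hx, hA, mt this.2 hA]
  rwa [integral_indicator hm, setIntegral_const, smul_eq_mul, mul_one, measureReal_def,
    measure_toMeasurable] at h1

/-- The moment conditions on the indicator function of `K`, rewritten as bounds on the first two
moments of the restriction of the Gaussian measure to `K`. -/
theorem abs_setIntegral_le_of_moments {n : ℕ} {K : Set (EuclideanSpace ℝ (Fin n))}
    (hK : MeasurableSet K) {v : EuclideanSpace ℝ (Fin n)} {δ : ℝ}
    (h : ∀ p : Polynomial ℝ, IsNormalizedMeanZeroQuadratic p →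
      |∫ x, K.indicator 1 x * p.eval (inner ℝ v x) ∂(stdGaussian (EuclideanSpace ℝ (Fin n)))| < δ) :
    |∫ x in K, inner ℝ v x ∂stdGaussian (EuclideanSpace ℝ (Fin n))| ≤ δ ∧
    (stdGaussian (EuclideanSpace ℝ (Fin n))).real K -
      ∫ x in K, (inner ℝ v x) ^ 2 ∂stdGaussian (EuclideanSpace ℝ (Fin n)) ≤
        Real.sqrt (∫ t : ℝ, (t ^ 2 - 1) ^ 2 ∂gaussianReal 0 1) * δ := by
  set γ := stdGaussian (EuclideanSpace ℝ (Fin n))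
  have hind : ∀ F : EuclideanSpace ℝ (Fin n) → ℝ,
      ∫ x, K.indicator 1 x * F x ∂γ = ∫ x in K, F x ∂γ := by
    intro F
    rw [← integral_indicator hK]
    refine integral_congr_ae (ae_of_all _ fun x => ?_)
    by_cases hx : x ∈ K <;> simp [hx]
  constructor
  · have := h _ isNormalizedMeanZeroQuadratic_X
    simp only [Polynomial.eval_X] at this
    rw [hind] at this
    exact this.le
  · have := h _ isNormalizedMeanZeroQuadratic_sq_sub_one
    have hpos := Real.sqrt_pos.2 integral_sq_sub_one_sq_gaussianReal_pos
    set D := Real.sqrt (∫ t : ℝ, (t ^ 2 - 1) ^ 2 ∂gaussianReal 0 1)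
    simp only [Polynomial.eval_mul, Polynomial.eval_C, Polynomial.eval_sub, Polynomial.eval_pow,
      Polynomial.eval_X, Polynomial.eval_one] at this
    rw [hind, integral_const_mul,
      integral_sub (integrable_inner_pow_stdGaussian v 2).integrableOn (integrable_const _),
      setIntegral_const, smul_eq_mul, mul_one, abs_mul, abs_of_pos (inv_pos.2 hpos),
      inv_mul_lt_iff₀ hpos] at this
    linarith [neg_abs_le (∫ x in K, (inner ℝ v x) ^ 2 ∂γ - γ.real K)]

/-! ### Choice of scales and conclusion -/

/-- The scales are `δ = μ²²`, `s = μ⁵`, `L = μ⁻¹` and `c ≥ μ³`. The moment error is then of order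
`μ¹⁶` and the truncation error of order `μ¹⁷`; the spare factor `μ` absorbs the constants. -/
theorem facet_bound_le {μ c D P : ℝ} (hμ0 : 0 < μ) (hμ1 : μ ≤ 1) (hc : μ ^ 3 ≤ c) (hD : 0 ≤ D)
    (hP : 0 ≤ P) (h : μ * (2 * (1 + D) + 2 * P) ≤ 1) :
    2 * (1 + D) * μ ^ 22 / c ^ 2 + 2 * μ ^ 5 * P / (c * μ⁻¹ ^ 15) ≤ μ ^ 15 := by
  have hc0 : 0 < c := lt_of_lt_of_le (by positivity) hc
  have b1 : 2 * (1 + D) * μ ^ 22 / c ^ 2 ≤ 2 * (1 + D) * μ ^ 16 := by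
    rw [div_le_iff₀ (by positivity)]
    calc 2 * (1 + D) * μ ^ 22 = 2 * (1 + D) * μ ^ 16 * (μ ^ 3) ^ 2 := by ring
      _ ≤ _ := by gcongr
  have b2 : 2 * μ ^ 5 * P / (c * μ⁻¹ ^ 15) ≤ 2 * P * μ ^ 17 := by
    rw [div_le_iff₀ (by positivity)]
    calc 2 * μ ^ 5 * P = 2 * P * μ ^ 17 * (μ ^ 3 * μ⁻¹ ^ 15) := by field_simp
      _ ≤ _ := by gcongr
  have b3 : μ ^ 17 ≤ μ ^ 16 := pow_le_pow_of_le_one hμ0.le hμ1 (by norm_num)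
  have b4 : 2 * P * μ ^ 17 ≤ 2 * P * μ ^ 16 := by gcongr
  have b5 : μ ^ 15 * (μ * (2 * (1 + D) + 2 * P)) ≤ μ ^ 15 * 1 := by gcongr
  linarith

theorem exists_intersectionOfLTFs_approx {n k : ℕ} (hk : 0 < k)
    {f : EuclideanSpace ℝ (Fin n) → ℝ} {V : Submodule ℝ (EuclideanSpace ℝ (Fin n))} {μ : ℝ}
    (hμ0 : 0 < μ) (hμ8 : μ ≤ 1 / 8)
    (hμ : μ * (2 * (1 + Real.sqrt (∫ t : ℝ, (t ^ 2 - 1) ^ 2 ∂gaussianReal 0 1)) +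
      2 * ∫ t : ℝ, t ^ 16 ∂gaussianReal 0 1) ≤ 1)
    (hf : IsIntersectionOfLTFs k f)
    (hmom : ∀ v ∈ Vᗮ, ‖v‖ = 1 → ∀ p : Polynomial ℝ, IsNormalizedMeanZeroQuadratic p →
      |∫ x, f x * p.eval (inner ℝ v x) ∂(stdGaussian (EuclideanSpace ℝ (Fin n)))| < μ ^ 22) :
    ∃ g : EuclideanSpace ℝ (Fin n) → ℝ, IsIntersectionOfLTFs k g ∧
      (∀ x, g x = g (V.starProjection x)) ∧
      ∫ x, |f x - g x| ∂(stdGaussian (EuclideanSpace ℝ (Fin n))) ≤ 19 * (k * μ ^ 2) := by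
  classical
  obtain ⟨w, θ, hw, rfl⟩ := hf.exists_halfspaces
  set γ := stdGaussian (EuclideanSpace ℝ (Fin n))
  set K := {x : EuclideanSpace ℝ (Fin n) | ∀ j, 0 ≤ inner ℝ (w j) x + θ j} with hK
  have hk1 : (1 : ℝ) ≤ k := by exact_mod_cast hk
  have hμ1 : μ ≤ 1 := by linarith
  have hKclosed : IsClosed K := by
    simpa using isClosed_setOf_forall_mem_halfspace Set.univ w θ
  have hKconv : Convex ℝ K := by
    simpa using convex_setOf_forall_mem_halfspace Set.univ w θ
  rcases le_or_gt (γ.real K) (k * μ ^ 2) with hsmall | hlarge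
  · refine ⟨fun _ => 0, isIntersectionOfLTFs_zero hk, fun _ => rfl, ?_⟩
    have h1 := integral_abs_sub_indicator_le (A := K) (B := ∅) (U := K) (by simp)
    have h2 : 0 ≤ (k : ℝ) * μ ^ 2 := by positivity
    simp only [Set.indicator_empty] at h1
    linarith
  set S : Finset (Fin k) := Finset.univ.filter fun j => μ ^ 3 < ‖w j - V.starProjection (w j)‖
    with hS
  set K₀ := {x : EuclideanSpace ℝ (Fin n) | ∀ j ∈ (Sᶜ : Set (Fin k)), 0 ≤ inner ℝ (w j) x + θ j}
    with hK₀
  set A := {x : EuclideanSpace ℝ (Fin n) | ∀ j ∈ S, 0 ≤ inner ℝ (w j) x + θ j} with hA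
  have hKA : K₀ ∩ A = K := by
    ext x
    constructor
    · intro h j
      by_cases hj : j ∈ S
      · exact h.2 j hj
      · exact h.1 j hj
    · exact fun h => ⟨fun j _ => h j, fun j _ => h j⟩
  have hAm : MeasurableSet A := (isClosed_setOf_forall_mem_halfspace (S : Set (Fin k)) w θ).measurableSet
  have hunit : ∀ j ∈ S, ‖w j‖ = 1 := by
    intro j hj
    refine (hw j).resolve_left fun h0 => ?_
    have := (Finset.mem_filter.1 hj).2
    rw [h0] at this
    simp only [map_zero, sub_zero, norm_zero] at this
    exact absurd this (not_lt.2 (by positivity))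
  -- little mass of `K` is near the boundaries of the half-spaces indexed by `S`
  have hfacet : ∀ j ∈ S, ∫ x in K, Real.exp (-((inner ℝ (w j) x + θ j) / μ ^ 5)) ∂γ ≤ μ ^ 15 := by
    intro j hj
    set u := w j - V.starProjection (w j) with hu
    have hc : μ ^ 3 < ‖u‖ := (Finset.mem_filter.1 hj).2
    have hc0 : 0 < ‖u‖ := lt_trans (by positivity) hc
    have huV : u ∈ Vᗮ := V.sub_starProjection_mem_orthogonal (w j)
    -- The direction orthogonal to `V` that makes `v · w j` largest, namely `‖u‖`.
    set v := ‖u‖⁻¹ • u with hv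
    have hv1 : ‖v‖ = 1 := by rw [hv, norm_smul, norm_inv, norm_norm, inv_mul_cancel₀ hc0.ne']
    have hvw : inner ℝ v (w j) = ‖u‖ := by
      have h1 : inner ℝ u (w j) = ‖u‖ ^ 2 := by
        have h2 : w j = u + V.starProjection (w j) := by rw [hu]; abel
        rw [h2, inner_add_right, real_inner_self_eq_norm_sq,
          Submodule.inner_left_of_mem_orthogonal (V.starProjection_apply_mem _) huV, add_zero]
      rw [hv, real_inner_smul_left, h1]
      field_simp
    obtain ⟨hm1, hm2⟩ := abs_setIntegral_le_of_moments hKclosed.measurableSet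
      (hmom v (Vᗮ.smul_mem _ huV) hv1)
    have hδκ : μ ^ 22 ≤ γ.real K := by
      have h1 : μ ^ 22 ≤ μ ^ 2 := pow_le_pow_of_le_one hμ0.le hμ1 (by norm_num)
      nlinarith [sq_nonneg μ]
    have hsL : μ ^ 5 * (1 + μ⁻¹) ≤ ‖u‖ / 4 := by
      have h1 : μ ^ 5 * (1 + μ⁻¹) = μ ^ 3 * (μ ^ 2 + μ) := by field_simp
      have h2 : μ ^ 2 + μ ≤ 1 / 4 := by nlinarith
      have h3 : μ ^ 3 * (μ ^ 2 + μ) ≤ μ ^ 3 * (1 / 4) := by gcongr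
      linarith
    have h := setIntegral_exp_neg_le hKclosed hKconv hv1 (hunit j hj) (fun x hx => hx j) hvw hc0
      (s := μ ^ 5) (by positivity) (L := μ⁻¹) (by positivity) hsL (by positivity) hδκ hm1 hm2
    refine h.trans ?_
    exact facet_bound_le hμ0 hμ1 hc.le (Real.sqrt_nonneg _)
      (integral_nonneg fun t => by positivity) hμ
  have hcut : γ.real K₀ - γ.real K ≤ 16 * (k * μ ^ 2) := by
    rcases S.eq_empty_or_nonempty with hSe | hSe
    · have : A = Set.univ := by
        rw [hA, hSe]; simp
      rw [this, Set.inter_univ] at hKA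
      rw [hKA, sub_self]
      positivity
    have hY : ∫ x in K, Real.exp (-(Metric.infDist x Aᶜ / μ ^ 5)) ∂γ ≤ k * μ ^ 15 := by
      have hint : ∀ j ∈ S, Integrable (fun x => Real.exp (-((inner ℝ (w j) x + θ j) / μ ^ 5)))
          (γ.restrict K) := by
        intro j hj
        refine IntegrableOn.of_bound (measure_lt_top _ _) (by fun_prop) 1
          ((ae_restrict_iff' hKclosed.measurableSet).2 (ae_of_all _ fun x hx => ?_))
        rw [Real.norm_of_nonneg (Real.exp_nonneg _), Real.exp_le_one_iff]
        exact neg_nonpos.2 (div_nonneg (hx j) (by positivity))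
      calc _ ≤ ∫ x in K, ∑ j ∈ S, Real.exp (-((inner ℝ (w j) x + θ j) / μ ^ 5)) ∂γ :=
            integral_mono_of_nonneg (ae_of_all _ fun x => Real.exp_nonneg _)
              (integrable_finsetSum S hint)
              (ae_of_all _ fun x => exp_neg_infDist_le_sum S hSe w hunit θ (by positivity) x)
        _ = ∑ j ∈ S, ∫ x in K, Real.exp (-((inner ℝ (w j) x + θ j) / μ ^ 5)) ∂γ :=
            integral_finsetSum S hint
        _ ≤ ∑ j ∈ S, μ ^ 15 := Finset.sum_le_sum hfacet
        _ ≤ k * μ ^ 15 := by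
            rw [Finset.sum_const, nsmul_eq_mul]
            have : S.card ≤ k := by simpa using S.card_le_univ
            gcongr
    have h13 : μ ^ 13 ≤ 1 / 4 := by
      have := pow_le_pow_of_le_one hμ0.le hμ1 (show 1 ≤ 13 by norm_num)
      linarith
    have hY4 : ∫ x in K, Real.exp (-(Metric.infDist x Aᶜ / μ ^ 5)) ∂γ ≤ γ.real K / 4 := by
      refine hY.trans ?_
      have : k * μ ^ 15 ≤ k * μ ^ 2 / 4 := by
        calc k * μ ^ 15 = k * μ ^ 2 * μ ^ 13 := by ring
          _ ≤ k * μ ^ 2 * (1 / 4) := by gcongr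
          _ = _ := by ring
      linarith
    have h := measureReal_sub_measureReal_inter_mul_le
      (isClosed_setOf_forall_mem_halfspace _ w θ) (convex_setOf_forall_mem_halfspace _ w θ)
      hAm (K := K₀) (s := μ ^ 5) (by positivity) (by rwa [hKA])
    rw [hKA] at h
    have h1 : (γ.real K₀ - γ.real K) * γ.real K ≤ 16 * k * μ ^ 5 := by
      refine h.trans ?_
      calc _ ≤ 16 / (μ ^ 5) ^ 2 * (k * μ ^ 15) := by gcongr
        _ = _ := by field_simp
    have h0 : 0 ≤ γ.real K₀ - γ.real K := by
      have : γ.real K ≤ γ.real K₀ := measureReal_mono (hKA ▸ Set.inter_subset_left)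
      linarith
    -- Here the lower bound `γ K > k μ²` from the case split is used; dividing by `k μ²` leaves `16
    -- μ³`.
    have h2 : (γ.real K₀ - γ.real K) * (k * μ ^ 2) ≤ 16 * μ ^ 3 * (k * μ ^ 2) := by
      have : (γ.real K₀ - γ.real K) * (k * μ ^ 2) ≤ (γ.real K₀ - γ.real K) * γ.real K := by
        gcongr
      linarith
    have h3 := le_of_mul_le_mul_right h2 (by positivity)
    have h4 : μ ^ 3 ≤ μ ^ 2 := pow_le_pow_of_le_one hμ0.le hμ1 (by norm_num)
    nlinarith [sq_nonneg μ]
  set E : Fin k → Set (EuclideanSpace ℝ (Fin n)) := fun j =>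
    {x | ¬(0 ≤ inner ℝ (w j) x + θ j ↔ 0 ≤ inner ℝ (V.starProjection (w j)) x + θ j)} with hE
  have hproj : ∀ j ∈ Sᶜ, γ.real (E j) ≤ 3 * μ ^ 2 := by
    intro j hj
    have hj' : ‖w j - V.starProjection (w j)‖ ≤ μ ^ 3 := by
      simpa [hS] using hj
    rcases hw j with h0 | h1
    · have : E j = ∅ := by
        ext x; simp [hE, h0]
      rw [this, measureReal_empty]; positivity
    · have h2 : 1 / 2 ≤ ‖V.starProjection (w j)‖ := by
        have h3 := norm_sub_norm_le (w j) (V.starProjection (w j))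
        have h4 := pow_le_pow_of_le_one hμ0.le hμ1 (show 1 ≤ 3 by norm_num)
        linarith
      have h5 := measureReal_halfspace_symmDiff_le h2 (c := μ ^ 3) (T := μ⁻¹) (by positivity)
        (by positivity) hj' (θ j)
      refine h5.trans (le_of_eq ?_)
      field_simp
      ring
  -- Dropped half-spaces become the trivial condition `0 ≤ 0`, so the number of threshold functions
  -- remains `k`.
  refine ⟨{x | ∀ j, 0 ≤ inner ℝ (if j ∈ S then 0 else V.starProjection (w j)) x +
      (if j ∈ S then 0 else θ j)}.indicator 1, isIntersectionOfLTFs_of_forall _ _ fun x => rfl,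
    fun x => ?_, ?_⟩
  · have : ∀ j, inner ℝ (if j ∈ S then 0 else V.starProjection (w j)) x =
        (inner ℝ (if j ∈ S then 0 else V.starProjection (w j)) (V.starProjection x) : ℝ) := by
      intro j
      split_ifs
      · simp
      · rw [← Submodule.inner_starProjection_left_eq_right,
          Submodule.starProjection_eq_self_iff.2 (V.starProjection_apply_mem _)]
    rw [Set.indicator_apply, Set.indicator_apply]
    refine if_congr (forall_congr' fun j => ?_) rfl rfl
    rw [this j]
  · refine (integral_abs_sub_indicator_le (U := (K₀ \ K) ∪ ⋃ j ∈ Sᶜ, E j) fun x hx => ?_).trans ?_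
    · simp only [Set.mem_union, Set.mem_sdiff, Set.mem_iUnion, not_or, not_exists, not_and,
        not_not] at hx
      have hEj : ∀ j, j ∉ S → (0 ≤ inner ℝ (w j) x + θ j ↔
          0 ≤ inner ℝ (V.starProjection (w j)) x + θ j) := fun j hj => by
        have := hx.2 j (Finset.mem_compl.2 hj)
        simpa [hE] using this
      constructor
      · intro h j
        split_ifs with hj
        · simp
        · exact (hEj j hj).1 (h j)
      · intro h
        refine hx.1 fun j hj => ?_
        have hj' : j ∉ S := hj
        have := h j
        rw [if_neg hj', if_neg hj'] at this
        exact (hEj j hj').2 this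
    · refine (measureReal_union_le _ _).trans ?_
      have h1 : γ.real (K₀ \ K) ≤ 16 * (k * μ ^ 2) := by
        rw [measureReal_sdiff (hKA ▸ Set.inter_subset_left) hKclosed.measurableSet]
        exact hcut
      have h2 : γ.real (⋃ j ∈ Sᶜ, E j) ≤ 3 * (k * μ ^ 2) := by
        refine (measureReal_biUnion_finset_le _ _).trans ((Finset.sum_le_sum hproj).trans ?_)
        rw [Finset.sum_const, nsmul_eq_mul]
        have : (Sᶜ).card ≤ k := by simpa using (Sᶜ).card_le_univ
        calc ((Sᶜ).card : ℝ) * (3 * μ ^ 2) ≤ k * (3 * μ ^ 2) := by gcongr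
          _ = _ := by ring
      linarith

theorem mainTheorem10 :
    ∃ C : ℝ, 0 < C ∧
      ∀ (n k : ℕ) (δ : ℝ) (f : EuclideanSpace ℝ (Fin n) → ℝ)
        (V : Submodule ℝ (EuclideanSpace ℝ (Fin n))),
        0 < δ → δ ≤ (k : ℝ) / 2 →
        IsIntersectionOfLTFs k f →
        (∀ v ∈ Vᗮ, ‖v‖ = 1 → ∀ p : Polynomial ℝ, IsNormalizedMeanZeroQuadratic p →
          |∫ x, f x * p.eval (inner ℝ v x) ∂(stdGaussian (EuclideanSpace ℝ (Fin n)))| < δ) →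
        ∃ (k' : ℕ) (g : EuclideanSpace ℝ (Fin n) → ℝ),
          k' ≤ k ∧ IsIntersectionOfLTFs k' g ∧
          (∀ x, g x = g (V.starProjection x)) ∧
          ∫ x, |f x - g x| ∂(stdGaussian (EuclideanSpace ℝ (Fin n))) ≤
            C * δ ^ ((1 : ℝ) / 11) * (k : ℝ) ^ ((15 : ℝ) / 11)
              * Real.log ((k : ℝ) / δ) ^ ((2 : ℝ) / 11) := by
  obtain ⟨R, hR0, hR⟩ : ∃ R : ℝ, 0 ≤ R ∧
      2 * (1 + Real.sqrt (∫ t : ℝ, (t ^ 2 - 1) ^ 2 ∂gaussianReal 0 1)) +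
        2 * ∫ t : ℝ, t ^ 16 ∂gaussianReal 0 1 = R := by
    refine ⟨_, ?_, rfl⟩
    have : 0 ≤ ∫ t : ℝ, t ^ 16 ∂gaussianReal 0 1 := integral_nonneg fun t => by positivity
    positivity
  set μ₀ := (8 + R)⁻¹ with hμ₀
  have hμ₀0 : 0 < μ₀ := by positivity
  -- The logarithmic factor may be as small as `1/2`, so `38 = 2 · 19` serves small `μ`; the term `2
  -- / μ₀²` makes the bound at least 1 once `μ > μ₀`.
  refine ⟨38 + 2 / μ₀ ^ 2, by positivity, fun n k δ f V hδ hδk hf hmom => ?_⟩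
  have hk : 0 < k := by
    rcases Nat.eq_zero_or_pos k with rfl | h
    · norm_num at hδk; linarith
    · exact h
  have hk1 : (1 : ℝ) ≤ k := by exact_mod_cast hk
  set μ := δ ^ ((1 : ℝ) / 22) with hμ
  have hμ0 : 0 < μ := by positivity
  have hμ22 : μ ^ 22 = δ := by
    rw [hμ, ← Real.rpow_natCast, ← Real.rpow_mul hδ.le]; norm_num
  have hμ2 : μ ^ 2 = δ ^ ((1 : ℝ) / 11) := by
    rw [hμ, ← Real.rpow_natCast, ← Real.rpow_mul hδ.le]; norm_num
  have hlog : (1 : ℝ) / 2 ≤ Real.log (k / δ) ^ ((2 : ℝ) / 11) := by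
    have h2 : Real.log 2 ≤ Real.log (k / δ) := by
      refine Real.log_le_log (by norm_num) ?_
      rw [le_div_iff₀ hδ]; linarith
    have h3 : (1 : ℝ) / 2 ≤ Real.log 2 := by linarith [Real.log_two_gt_d9]
    calc (1 : ℝ) / 2 = ((1 : ℝ) / 2) ^ (1 : ℝ) := by rw [Real.rpow_one]
      _ ≤ ((1 : ℝ) / 2) ^ ((2 : ℝ) / 11) :=
          Real.rpow_le_rpow_of_exponent_ge (by norm_num) (by norm_num) (by norm_num)
      _ ≤ _ := Real.rpow_le_rpow (by norm_num) (h3.trans h2) (by norm_num)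
  have hkpow : (k : ℝ) ≤ (k : ℝ) ^ ((15 : ℝ) / 11) := by
    calc (k : ℝ) = (k : ℝ) ^ (1 : ℝ) := by rw [Real.rpow_one]
      _ ≤ _ := Real.rpow_le_rpow_of_exponent_le hk1 (by norm_num)
  have hrhs : ∀ B : ℝ, 0 ≤ B → B * (k * μ ^ 2) / 2 ≤
      B * δ ^ ((1 : ℝ) / 11) * (k : ℝ) ^ ((15 : ℝ) / 11) *
        Real.log ((k : ℝ) / δ) ^ ((2 : ℝ) / 11) := by
    intro B hB
    rw [← hμ2]
    calc B * (k * μ ^ 2) / 2 = B * μ ^ 2 * k * (1 / 2) := by ring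
      _ ≤ _ := by gcongr
  rcases le_or_gt μ μ₀ with hle | hgt
  · have h8 : μ ≤ 1 / 8 := by
      refine hle.trans ?_
      rw [hμ₀, one_div]
      exact inv_anti₀ (by norm_num) (by linarith)
    have hR1 : μ * R ≤ 1 := by
      have : μ * R ≤ (8 + R)⁻¹ * (8 + R) :=
        mul_le_mul hle (by linarith) hR0 (by positivity)
      rwa [inv_mul_cancel₀ (by positivity)] at this
    obtain ⟨g, hg, hgV, hfg⟩ := exists_intersectionOfLTFs_approx hk hμ0 h8 (by rwa [hR]) hf
      (by rwa [hμ22])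
    refine ⟨k, g, le_rfl, hg, hgV, hfg.trans (le_trans ?_ (hrhs _ (by positivity)))⟩
    have : 0 ≤ 2 / μ₀ ^ 2 * (k * μ ^ 2) := by positivity
    linarith
  · refine ⟨k, fun _ => 0, le_rfl, isIntersectionOfLTFs_zero hk, fun _ => rfl,
      le_trans ?_ (hrhs _ (by positivity))⟩
    obtain ⟨w, θ, -, rfl⟩ := hf.exists_halfspaces
    have h1 := integral_abs_sub_indicator_le (n := n)
      (A := {x | ∀ j, 0 ≤ inner ℝ (w j) x + θ j}) (B := ∅) (U := Set.univ) (by simp)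
    simp only [Set.indicator_empty, probReal_univ] at h1
    refine h1.trans ?_
    have h2 : 1 ≤ μ ^ 2 / μ₀ ^ 2 := by
      rw [one_le_div (by positivity)]
      gcongr
    have h3 : μ ^ 2 / μ₀ ^ 2 ≤ k * (μ ^ 2 / μ₀ ^ 2) := le_mul_of_one_le_left (by positivity) hk1
    have h4 : (38 + 2 / μ₀ ^ 2) * (k * μ ^ 2) / 2 = 19 * (k * μ ^ 2) + k * (μ ^ 2 / μ₀ ^ 2) := by
      ring
    have h5 : 0 ≤ 19 * (k * μ ^ 2) := by positivity
    linarith
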